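/- Let $R$ be a commutative noetherian ring, and let $\operatorname{Max}R\subseteq\operatorname{Spec}R$ be the set of maximal ideals of $R$, a specialization-closed subset. For a specialization-closed subset $\Phi$ of $\operatorname{Spec}R$ let $\Gamma_\Phi:\operatorname{Mod}R\to\operatorname{Mod}R$ be the torsion functor $\Gamma_\Phi(M)=\{x\in M\mid \operatorname{Supp}(Rx)\subseteq\Phi\}$, let $\mathrm{H}^i_\Phi$ be its $i$-th right derived functor, and define the cohomological dimension of $\Phi$ by $$\operatorname{cd}\Phi=\sup\{i\mid \mathrm{H}^i_\Phi(M)\neq 0\text{ for some }R\text{-module }M\}\in\mathbb{Z}_{\ge0}\cup\{\infty,-\infty\}.$$ Then $$\operatorname{cd}(\operatorname{Max}R)<\infty\iff \dim R<\infty,$$ where $\dim R$ is the Krull dimension of $R$ ($-\infty$ if $R=0$). In particular, $\operatorname{cd}(\operatorname{Max}R)=\infty$ whenever $\dim R=\infty$. -/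

import Mathlib

open CategoryTheory

universe u

namespace LocalCohomologySpec

/-- The `Φ`-torsion submodule `Γ_Φ(M) = {x ∈ M ∣ Supp (Rx) ⊆ Φ}` of an `R`-module `M`,
for a subset `Φ` of `Spec R`. -/
def torsionSubmodule {R : Type u} [CommRing R] (Φ : Set (PrimeSpectrum R))
    (M : Type u) [AddCommGroup M] [Module R M] : Submodule R M where
  carrier := {x | Module.support R (Submodule.span R {x}) ⊆ Φ}
  zero_mem' := by
    intro p hp
    obtain ⟨m, hm⟩ := Module.mem_support_iff'.mp hp
    have h0 : m = 0 := by
      obtain ⟨m, h⟩ := m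
      simpa [Submodule.mem_span_singleton] using h
    exact absurd (by simp [h0]) (hm 1 p.asIdeal.primeCompl.one_mem)
  add_mem' := by
    intro x y hx hy p hp
    by_contra hpΦ
    have key : ∀ z : M, Module.support R (Submodule.span R {z}) ⊆ Φ →
        ∃ r ∉ p.asIdeal, r • z = 0 := by
      intro z hz
      have hn : p ∉ Module.support R (Submodule.span R {z}) := fun h => hpΦ (hz h)
      obtain ⟨r, hr, h⟩ := Module.notMem_support_iff'.mp hn
        ⟨z, Submodule.mem_span_singleton_self z⟩
      exact ⟨r, hr, congrArg Subtype.val h⟩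
    obtain ⟨r, hr, hrx⟩ := key x hx
    obtain ⟨s, hs, hsy⟩ := key y hy
    refine Module.notMem_support_iff'.mpr ?_ hp
    rintro ⟨m, hm⟩
    obtain ⟨a, rfl⟩ := Submodule.mem_span_singleton.mp hm
    refine ⟨r * s, p.asIdeal.primeCompl.mul_mem hr hs, Subtype.ext ?_⟩
    change (r * s) • a • (x + y) = 0
    have e : (r * s) • a • (x + y) = (s * a) • (r • x) + (r * a) • (s • y) := by
      module
    rw [e, hrx, hsy, smul_zero, smul_zero, add_zero]
  smul_mem' := by
    intro c x hx
    have hle : Submodule.span R {c • x} ≤ Submodule.span R {x} :=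
      Submodule.span_singleton_smul_le R c x
    exact (Module.support_subset_of_injective (Submodule.inclusion hle)
      (Submodule.inclusion_injective hle)).trans hx

/-- A linear map sends `Φ`-torsion elements to `Φ`-torsion elements. -/
lemma map_mem_torsionSubmodule {R : Type u} [CommRing R] (Φ : Set (PrimeSpectrum R))
    {M N : Type u} [AddCommGroup M] [Module R M] [AddCommGroup N] [Module R N]
    (f : M →ₗ[R] N) {x : M} (hx : x ∈ torsionSubmodule Φ M) :
    f x ∈ torsionSubmodule Φ N := by
  have hf : ∀ y ∈ Submodule.span R {x}, f y ∈ Submodule.span R {f x} := by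
    intro y hy
    obtain ⟨a, rfl⟩ := Submodule.mem_span_singleton.mp hy
    exact Submodule.mem_span_singleton.mpr ⟨a, (map_smul f a x).symm⟩
  refine (Module.support_subset_of_surjective (f.restrict hf) ?_).trans hx
  rintro ⟨z, hz⟩
  obtain ⟨a, rfl⟩ := Submodule.mem_span_singleton.mp hz
  exact ⟨⟨a • x, Submodule.mem_span_singleton.mpr ⟨a, rfl⟩⟩, Subtype.ext (map_smul f a x)⟩

/-- The `Φ`-torsion functor `Γ_Φ : Mod R ⥤ Mod R`. -/
def torsionFunctor {R : Type u} [CommRing R] (Φ : Set (PrimeSpectrum R)) :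
    ModuleCat.{u} R ⥤ ModuleCat.{u} R where
  obj M := ModuleCat.of R (torsionSubmodule Φ M)
  map {M N} f := ModuleCat.ofHom (f.hom.restrict
    (p := torsionSubmodule Φ M) (q := torsionSubmodule Φ N)
    fun _ hx => map_mem_torsionSubmodule Φ f.hom hx)

instance {R : Type u} [CommRing R] (Φ : Set (PrimeSpectrum R)) :
    (torsionFunctor Φ).Additive where

/-- The `n`-th local cohomology functor `H^n_Φ` with respect to `Φ`: the `n`-th right derived
functor of `Γ_Φ`. -/
noncomputable def localCohomologyFunctor {R : Type u} [CommRing R]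
    (Φ : Set (PrimeSpectrum R)) (n : ℕ) : ModuleCat.{u} R ⥤ ModuleCat.{u} R :=
  (torsionFunctor Φ).rightDerived n

/-- The cohomological dimension `cd Φ = sup {n ∣ H^n_Φ(M) ≠ 0 for some R-module M}`, with values
in `ℕ ∪ {∞, -∞}`. -/
noncomputable def cohomologicalDimension {R : Type u} [CommRing R]
    (Φ : Set (PrimeSpectrum R)) : WithBot ℕ∞ :=
  sSup {d | ∃ n : ℕ, (∃ M : ModuleCat.{u} R,
    ¬ Limits.IsZero ((localCohomologyFunctor Φ n).obj M)) ∧ d = (n : WithBot ℕ∞)}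

/-- The set `Max R` of maximal ideals of `R`, as a subset of `Spec R`. -/
def maxSpec (R : Type u) [CommRing R] : Set (PrimeSpectrum R) :=
  {p | p.asIdeal.IsMaximal}

/-- `Max R` is specialization-closed. -/
lemma stableUnderSpecialization_maxSpec (R : Type u) [CommRing R] :
    StableUnderSpecialization (maxSpec R) := by
  intro p q hpq hp
  have hle : p.asIdeal ≤ q.asIdeal := (PrimeSpectrum.le_iff_specializes p q).mpr hpq
  have he : p = q :=
    PrimeSpectrum.ext (Ideal.IsMaximal.eq_of_le (hI := hp) q.isPrime.ne_top hle)
  exact he ▸ hp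

end LocalCohomologySpec

/-! Both implications come from comparing cd(Max R) with dim R: if dim R ≤ d then cd ≤ d, and dim R
≤ cd always.

Upper bound. Local cohomology is effaced by finite modules (`exists_finite_map_eq`), so vanishing
above d need only be shown for finite M. Induct on the dimension of the support and use prime
filtrations to reduce to R/p. If p is maximal, R/p is torsion, and torsion modules are acyclic
(`subsingleton_of_isTorsion`). Otherwise each cohomology class is killed by some r outside p, which
is regular on R/p, so the class comes from the cohomology of (R/p)/r(R/p), of smaller dimension
(`subsingleton_of_supportDim_le`).

Lower bound. For a maximal ideal m of height n, restriction of scalars from R_m to R is exact,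
preserves injectives and commutes with torsion. Hence the n-th local cohomology of the R-module R_m
is that of R_m over itself, which is nonzero by Grothendieck's theorem
(`nontrivial_of_supportDim_eq`). Krull's height theorem makes every such n finite, and dim R is the
supremum of these heights.

Grothendieck's theorem is proved without completion or duality: local cohomology of a finite module
is artinian, and a decomposition of an artinian module into sup-irreducible submodules yields
finitely many primes that a suitable regular element must avoid.

The long exact sequence with natural connecting maps is obtained by resolving the epimorphism of a
short exact sequence in the category of arrows. -/

namespace CategoryTheory

open Category Limits

/-! ### Exact functors that preserve injectives. -/

section MapInjectiveResolution

variable {C D E E' : Type*} [Category* C] [Category* D] [Category* E] [Category* E']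
  [Abelian C] [Abelian D] [Abelian E] [Abelian E']

/-- An exact functor which preserves injective objects maps injective resolutions to injective
resolutions. -/
noncomputable def InjectiveResolution.mapOfInjective {X : C} (I : InjectiveResolution X)
    (G : C ⥤ D) [G.Additive] [PreservesFiniteLimits G] [PreservesFiniteColimits G]
    (hG : ∀ n, Injective (G.obj (I.cocomplex.X n))) : InjectiveResolution (G.obj X) where
  cocomplex := (G.mapHomologicalComplex _).obj I.cocomplex
  injective := hG
  ι := (HomologicalComplex.singleMapHomologicalComplex G _ 0).inv.app X ≫
    (G.mapHomologicalComplex _).map I.ι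

/-- Right derived functors commute with an exact functor preserving injective objects. -/
lemma Functor.nonempty_rightDerived_obj_iso [HasInjectiveResolutions C]
    [HasInjectiveResolutions D] (G : C ⥤ D)
    [G.Additive] [PreservesFiniteLimits G] [PreservesFiniteColimits G]
    (hG : ∀ I : C, Injective I → Injective (G.obj I)) (F : C ⥤ E) (F' : D ⥤ E') (G' : E ⥤ E')
    [F.Additive] [F'.Additive] [G'.Additive] [PreservesFiniteLimits G'] [PreservesFiniteColimits G']
    (e : G ⋙ F' ≅ F ⋙ G') (n : ℕ) (X : C) :
    Nonempty ((F'.rightDerived n).obj (G.obj X) ≅ G'.obj ((F.rightDerived n).obj X)) := by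
  let I := injectiveResolution X
  let J := I.mapOfInjective G fun n => hG _ inferInstance
  refine ⟨J.isoRightDerivedObj F' n ≪≫ (HomologicalComplex.homologyFunctor _ _ n).mapIso
    (HomologicalComplex.Hom.isoOfComponents (fun i => e.app (I.cocomplex.X i)) ?_ :
      (F'.mapHomologicalComplex _).obj J.cocomplex ≅
        (G'.mapHomologicalComplex _).obj ((F.mapHomologicalComplex _).obj I.cocomplex)) ≪≫
    (((F.mapHomologicalComplex _).obj I.cocomplex).sc n).mapHomologyIso G' ≪≫
    G'.mapIso (I.isoRightDerivedObj F n).symm⟩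
  intro i j _
  exact (e.hom.naturality (I.cocomplex.d i j)).symm

end MapInjectiveResolution

end CategoryTheory

/-! ### The five lemma for quasi-isomorphisms. -/

namespace HomologicalComplex.HomologySequence

open ComposableArrows Abelian

variable {C ι : Type*} [Category* C] [Abelian C] {c : ComplexShape ι}
  {S₁ S₂ : ShortComplex (HomologicalComplex C c)} (φ : S₁ ⟶ S₂)

lemma quasiIso_τ₁ (hS₁ : S₁.ShortExact) (hS₂ : S₂.ShortExact) (h₂ : QuasiIso φ.τ₂)
    (h₃ : QuasiIso φ.τ₃) : QuasiIso φ.τ₁ := by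
  rw [quasiIso_iff]
  intro j
  rw [quasiIsoAt_iff_isIso_homologyMap]
  by_cases hj : ∃ i, c.Rel i j
  · obtain ⟨i, hij⟩ := hj
    exact isIso_of_epi_of_isIso_of_isIso_of_mono
      (φ := δ₀Functor.map (mapComposableArrows₅ φ hS₁ hS₂ i j hij))
      ((composableArrows₅_exact hS₁ i j hij).δ₀)
      ((composableArrows₅_exact hS₂ i j hij).δ₀)
      (inferInstanceAs (Epi (homologyMap φ.τ₂ i)))
      (inferInstanceAs (IsIso (homologyMap φ.τ₃ i)))
      (inferInstanceAs (IsIso (homologyMap φ.τ₂ j)))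
      (inferInstanceAs (Mono (homologyMap φ.τ₃ j)))
  -- With no degree before `j`, the long exact sequence starts at H^j of the first term, so
  -- injectivity is inherited from the middle term.
  · have := hS₁.mono_f
    have := hS₂.mono_f
    have m₁ := mono_homologyMap_of_mono_of_not_rel S₁.f j (by simpa using hj)
    have m₂ := mono_homologyMap_of_mono_of_not_rel S₂.f j (by simpa using hj)
    have : Epi (homologyMap φ.τ₁ j) :=
      epi_of_mono_of_epi_of_mono (mapComposableArrows₂ φ j)
        (composableArrows₂_exact hS₁ j) (composableArrows₂_exact hS₂ j) m₂
        (inferInstanceAs (Epi (homologyMap φ.τ₂ j)))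
        (inferInstanceAs (Mono (homologyMap φ.τ₃ j)))
    have eq : homologyMap φ.τ₁ j ≫ homologyMap S₂.f j =
        homologyMap S₁.f j ≫ homologyMap φ.τ₂ j := by
      rw [← homologyMap_comp, ← homologyMap_comp, φ.comm₁₂]
    have : Mono (homologyMap φ.τ₁ j) := by
      have : Mono (homologyMap φ.τ₁ j ≫ homologyMap S₂.f j) := by
        rw [eq]; infer_instance
      exact mono_of_mono _ (homologyMap S₂.f j)
    exact isIso_of_mono_of_epi _

end HomologicalComplex.HomologySequence

/-! ### Injective objects in the category of arrows. -/

namespace CategoryTheory.ComposableArrows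

open Category Limits

variable {C : Type*} [Category* C]

lemma mono_of_mono_app₁ {X Y : ComposableArrows C 1} (f : X ⟶ Y) [Mono (f.app 0)]
    [Mono (f.app 1)] : Mono f := by
  have : ∀ i, Mono (f.app i) := fun i => by
    match i with
    | 0 => assumption
    | 1 => assumption
  exact NatTrans.mono_of_mono_app f

variable [Abelian C]

/-- A morphism from an arrow X to this projection amounts to independent maps X₀ ⟶ E and X₁ ⟶ E',
and each extends along a monomorphism. -/
lemma injective_mk₁_snd (E E' : C) [Injective E] [Injective E'] :
    Injective (mk₁ (biprod.snd : E ⊞ E' ⟶ E')) where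
  factors {X Y} g f _ := by
    let g₀ : X.obj 0 ⟶ E ⊞ E' := g.app 0
    let g₁ : X.obj 1 ⟶ E' := g.app 1
    have hg : X.map' 0 1 ≫ g₁ = g₀ ≫ biprod.snd := g.naturality _
    let l₀ : Y.obj 0 ⟶ E := Injective.factorThru (g₀ ≫ biprod.fst) (f.app 0)
    let l₁ : Y.obj 1 ⟶ E' := Injective.factorThru g₁ (f.app 1)
    have h₀ : f.app 0 ≫ l₀ = g₀ ≫ biprod.fst := Injective.comp_factorThru _ _
    have h₁ : f.app 1 ≫ l₁ = g₁ := Injective.comp_factorThru _ _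
    have hf : X.map' 0 1 ≫ f.app 1 = f.app 0 ≫ Y.map' 0 1 := f.naturality _
    refine ⟨homMk₁ (biprod.lift l₀ (Y.map' 0 1 ≫ l₁)) l₁ (biprod.lift_snd _ _).symm,
      hom_ext₁ ?_ h₁⟩
    change f.app 0 ≫ biprod.lift l₀ (Y.map' 0 1 ≫ l₁) = g₀
    ext
    · simpa using h₀
    · rw [assoc, biprod.lift_snd, ← reassoc_of% hf, h₁, hg]

/-- The embedding of an arrow into an injective arrow. -/
noncomputable def toInjective [EnoughInjectives C] (X : ComposableArrows C 1) :
    X ⟶ mk₁ (biprod.snd : Injective.under (X.obj 0) ⊞ Injective.under (X.obj 1) ⟶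
      Injective.under (X.obj 1)) :=
  homMk₁ (biprod.lift (Injective.ι _) (X.map' 0 1 ≫ Injective.ι _)) (Injective.ι _)
    (biprod.lift_snd _ _).symm

instance [EnoughInjectives C] (X : ComposableArrows C 1) : Mono (toInjective X) := by
  have h₀ : Mono ((toInjective X).app 0) := by
    have : Mono ((toInjective X).app 0 ≫ biprod.fst) := by
      have : (toInjective X).app 0 ≫ biprod.fst = Injective.ι (X.obj 0) := biprod.lift_fst _ _
      rw [this]; infer_instance
    exact mono_of_mono _ biprod.fst
  have h₁ : Mono ((toInjective X).app 1) := inferInstanceAs (Mono (Injective.ι (X.obj 1)))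
  exact mono_of_mono_app₁ _

instance [EnoughInjectives C] : EnoughInjectives (ComposableArrows C 1) where
  presentation X := ⟨{
    J := _
    injective := injective_mk₁_snd _ _
    f := toInjective X
    mono := inferInstance }⟩

section

variable [EnoughInjectives C] (I : ComposableArrows C 1) [Injective I]

/-- An injective arrow is a retract of a split epimorphism between injective objects. -/
noncomputable def ofInjective :
    mk₁ (biprod.snd : Injective.under (I.obj 0) ⊞ Injective.under (I.obj 1) ⟶
      Injective.under (I.obj 1)) ⟶ I :=
  Injective.factorThru (𝟙 I) (toInjective I)

lemma toInjective_ofInjective_app (i : Fin 2) :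
    (toInjective I).app i ≫ (ofInjective I).app i = 𝟙 _ :=
  NatTrans.congr_app (Injective.comp_factorThru (𝟙 I) (toInjective I)) i

lemma injective_obj_zero : Injective (I.obj 0) :=
  Retract.injective (Y := Injective.under (I.obj 0) ⊞ Injective.under (I.obj 1))
    ⟨(toInjective I).app 0, (ofInjective I).app 0, toInjective_ofInjective_app I 0⟩

lemma injective_obj_one : Injective (I.obj 1) :=
  Retract.injective (Y := Injective.under (I.obj 1))
    ⟨(toInjective I).app 1, (ofInjective I).app 1, toInjective_ofInjective_app I 1⟩

/-- The injective arrow is a retract of a projection, and retracts of split epimorphisms are split.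
-/
lemma isSplitEpi_map_of_injective : IsSplitEpi (I.map' 0 1) := by
  let s : Injective.under (I.obj 1) ⟶ Injective.under (I.obj 0) ⊞ Injective.under (I.obj 1) :=
    biprod.inr
  refine ⟨⟨(toInjective I).app 1 ≫ s ≫ (ofInjective I).app 0, ?_⟩⟩
  have h : biprod.snd ≫ (ofInjective I).app 1 = (ofInjective I).app 0 ≫ I.map' 0 1 :=
    (ofInjective I).naturality (homOfLE (by simp) : (0 : Fin 2) ⟶ 1)
  have h' : s ≫ biprod.snd = 𝟙 _ := biprod.inr_snd
  erw [assoc, assoc, ← h, reassoc_of% h', toInjective_ofInjective_app I 1]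
  rfl

end

end CategoryTheory.ComposableArrows

namespace CategoryTheory

open Category Limits ComposableArrows

lemma InjectiveResolution.mapOfInjective_ι_naturality {C D : Type*} [Category* C] [Category* D]
    [Abelian C] [Abelian D] {X : C} (I : InjectiveResolution X) {F G : C ⥤ D} (α : F ⟶ G)
    [F.Additive] [PreservesFiniteLimits F] [PreservesFiniteColimits F]
    [G.Additive] [PreservesFiniteLimits G] [PreservesFiniteColimits G]
    (hF : ∀ n, Injective (F.obj (I.cocomplex.X n)))
    (hG : ∀ n, Injective (G.obj (I.cocomplex.X n))) :
    (I.mapOfInjective F hF).ι ≫ (NatTrans.mapHomologicalComplex α _).app I.cocomplex =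
      (CochainComplex.single₀ D).map (α.app X) ≫ (I.mapOfInjective G hG).ι := by
  apply HomologicalComplex.from_single_hom_ext
  simp [mapOfInjective]
  exact (id_comp _).trans (congrArg _ (id_comp _).symm)

/-! ### Resolving a short exact sequence through its epimorphism. -/

section ArrowResolution

variable {C : Type*} [Category* C] [Abelian C]

/-- The morphism of complexes underlying a complex of arrows. -/
noncomputable abbrev arrowComplexHom (K : CochainComplex (ComposableArrows C 1) ℕ) :
    (((evaluation (Fin 2) C).obj 0).mapHomologicalComplex _).obj K ⟶
      (((evaluation (Fin 2) C).obj 1).mapHomologicalComplex _).obj K :=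
  (NatTrans.mapHomologicalComplex
    ((evaluation (Fin 2) C).map (homOfLE (by simp) : (0 : Fin 2) ⟶ 1)) _).app K

/-- The kernel sequence of the morphism of complexes underlying a complex of arrows. -/
noncomputable def arrowComplexKernel (K : CochainComplex (ComposableArrows C 1) ℕ) :
    ShortComplex (CochainComplex C ℕ) :=
  ShortComplex.mk (kernel.ι (arrowComplexHom K)) (arrowComplexHom K) (kernel.condition _)

/-- Functoriality of `arrowComplexKernel`. -/
noncomputable def arrowComplexKernelMap {K L : CochainComplex (ComposableArrows C 1) ℕ}
    (ψ : K ⟶ L) : arrowComplexKernel K ⟶ arrowComplexKernel L where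
  τ₁ := kernel.map _ _ ((((evaluation (Fin 2) C).obj 0).mapHomologicalComplex _).map ψ)
    ((((evaluation (Fin 2) C).obj 1).mapHomologicalComplex _).map ψ)
    ((NatTrans.mapHomologicalComplex _ _).naturality ψ).symm
  τ₂ := (((evaluation (Fin 2) C).obj 0).mapHomologicalComplex _).map ψ
  τ₃ := (((evaluation (Fin 2) C).obj 1).mapHomologicalComplex _).map ψ
  comm₁₂ := kernel.lift_ι _ _ _
  comm₂₃ := (NatTrans.mapHomologicalComplex _ _).naturality ψ

variable [EnoughInjectives C]

section

variable (K : CochainComplex (ComposableArrows C 1) ℕ) [∀ n, Injective (K.X n)]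

lemma isSplitEpi_arrowComplexHom_f (n : ℕ) : IsSplitEpi ((arrowComplexHom K).f n) :=
  isSplitEpi_map_of_injective (K.X n)

lemma shortExact_arrowComplexKernel : (arrowComplexKernel K).ShortExact where
  exact := ShortComplex.exact_of_f_is_kernel _ (kernelIsKernel _)
  mono_f := by dsimp [arrowComplexKernel]; infer_instance
  epi_g := by
    have := isSplitEpi_arrowComplexHom_f K
    exact HomologicalComplex.epi_of_epi_f (arrowComplexHom K) fun n => inferInstance

/-- The kernel sequence of a complex of injective arrows is degreewise split. -/
noncomputable def arrowComplexKernelSplitting (n : ℕ) :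
    ((arrowComplexKernel K).map (HomologicalComplex.eval C _ n)).Splitting :=
  have h := (HomologicalComplex.shortExact_iff_degreewise_shortExact _).1
    (shortExact_arrowComplexKernel K) n
  ShortComplex.Splitting.ofExactOfSection _ h.exact
    (isSplitEpi_arrowComplexHom_f K n).exists_splitEpi.some.section_
    (isSplitEpi_arrowComplexHom_f K n).exists_splitEpi.some.id h.mono_f

lemma injective_arrowComplexKernel_X₁ (n : ℕ) : Injective ((arrowComplexKernel K).X₁.X n) := by
  have : Injective ((K.X n).obj 0) := injective_obj_zero (K.X n)
  exact Retract.injective (Y := (K.X n).obj 0)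
    ⟨(arrowComplexKernel K).f.f n, (arrowComplexKernelSplitting K n).r,
      (arrowComplexKernelSplitting K n).f_r⟩

end

variable {S : ShortComplex C}

section

variable (I : InjectiveResolution (mk₁ S.g))

/-- The resolution of the middle term. -/
noncomputable def InjectiveResolution.arrowX₂ : InjectiveResolution S.X₂ :=
  I.mapOfInjective ((evaluation (Fin 2) C).obj 0) fun n => injective_obj_zero (I.cocomplex.X n)

/-- The resolution of the third term. -/
noncomputable def InjectiveResolution.arrowX₃ : InjectiveResolution S.X₃ :=
  I.mapOfInjective ((evaluation (Fin 2) C).obj 1) fun n => injective_obj_one (I.cocomplex.X n)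

lemma InjectiveResolution.arrow_ι_comp :
    I.arrowX₂.ι ≫ arrowComplexHom I.cocomplex =
      (CochainComplex.single₀ C).map S.g ≫ I.arrowX₃.ι :=
  I.mapOfInjective_ι_naturality ((evaluation (Fin 2) C).map (homOfLE (by simp) : (0 : Fin 2) ⟶ 1))
    (fun n => injective_obj_zero (I.cocomplex.X n)) (fun n => injective_obj_one (I.cocomplex.X n))

lemma InjectiveResolution.arrow_comp_ι_comp :
    ((CochainComplex.single₀ C).map S.f ≫ I.arrowX₂.ι) ≫ arrowComplexHom I.cocomplex = 0 := by
  have h : (CochainComplex.single₀ C).map S.f ≫ (CochainComplex.single₀ C).map S.g = 0 := by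
    rw [← Functor.map_comp, S.zero, Functor.map_zero]
  exact (assoc _ _ _).trans ((congrArg _ I.arrow_ι_comp).trans
    ((assoc _ _ _).symm.trans ((congrArg (· ≫ I.arrowX₃.ι) h).trans zero_comp)))

/-- The comparison from a short exact sequence to its resolution. -/
noncomputable def InjectiveResolution.arrowι :
    S.map (CochainComplex.single₀ C) ⟶ arrowComplexKernel I.cocomplex where
  τ₁ := kernel.lift _ ((CochainComplex.single₀ C).map S.f ≫ I.arrowX₂.ι) I.arrow_comp_ι_comp
  τ₂ := I.arrowX₂.ι
  τ₃ := I.arrowX₃.ι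
  comm₁₂ := kernel.lift_ι _ _ _
  comm₂₃ := I.arrow_ι_comp

/-- The resolution of the first term. -/
noncomputable def InjectiveResolution.arrowX₁ (hS : S.ShortExact) : InjectiveResolution S.X₁ where
  cocomplex := (arrowComplexKernel I.cocomplex).X₁
  injective := injective_arrowComplexKernel_X₁ _
  ι := I.arrowι.τ₁
  quasiIso := HomologicalComplex.HomologySequence.quasiIso_τ₁ I.arrowι
    (hS.map_of_exact (CochainComplex.single₀ C)) (shortExact_arrowComplexKernel _)
    I.arrowX₂.quasiIso I.arrowX₃.quasiIso

end

end ArrowResolution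

section ShortExactResolution

variable {C : Type*} [Category* C] [Abelian C]

/-- A degreewise split short exact sequence of injective resolutions of the terms of a
short complex. -/
structure ShortComplexResolution (S : ShortComplex C) where
  /-- the resolution of the first term -/
  I₁ : InjectiveResolution S.X₁
  /-- the resolution of the second term -/
  I₂ : InjectiveResolution S.X₂
  /-- the resolution of the third term -/
  I₃ : InjectiveResolution S.X₃
  /-- the first morphism -/
  f : I₁.cocomplex ⟶ I₂.cocomplex
  /-- the second morphism -/
  g : I₂.cocomplex ⟶ I₃.cocomplex
  w : f ≫ g = 0
  ι_f : I₁.ι ≫ f = (CochainComplex.single₀ C).map S.f ≫ I₂.ι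
  ι_g : I₂.ι ≫ g = (CochainComplex.single₀ C).map S.g ≫ I₃.ι
  splitting : ∀ n, Nonempty
    ((ShortComplex.mk f g w).map (HomologicalComplex.eval C _ n)).Splitting

/-- The resolution of a short exact sequence coming from an injective resolution in the category of
arrows. -/
noncomputable def InjectiveResolution.shortComplexResolution [EnoughInjectives C]
    {S : ShortComplex C} (I : InjectiveResolution (mk₁ S.g)) (hS : S.ShortExact) :
    ShortComplexResolution S where
  I₁ := I.arrowX₁ hS
  I₂ := I.arrowX₂
  I₃ := I.arrowX₃
  f := (arrowComplexKernel I.cocomplex).f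
  g := (arrowComplexKernel I.cocomplex).g
  w := (arrowComplexKernel I.cocomplex).zero
  ι_f := I.arrowι.comm₁₂
  ι_g := I.arrowι.comm₂₃
  splitting n := ⟨arrowComplexKernelSplitting I.cocomplex n⟩

lemma InjectiveResolution.mapOfInjective_ι_comp_map {C D : Type*} [Category* C] [Category* D]
    [Abelian C] [Abelian D] {X Y : C} (I : InjectiveResolution X) (J : InjectiveResolution Y)
    (φ : X ⟶ Y) (ψ : I.cocomplex ⟶ J.cocomplex)
    (h : I.ι ≫ ψ = (CochainComplex.single₀ C).map φ ≫ J.ι) (G : C ⥤ D)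
    [G.Additive] [PreservesFiniteLimits G] [PreservesFiniteColimits G]
    (hI : ∀ n, Injective (G.obj (I.cocomplex.X n)))
    (hJ : ∀ n, Injective (G.obj (J.cocomplex.X n))) :
    (I.mapOfInjective G hI).ι ≫ (G.mapHomologicalComplex _).map ψ =
      (CochainComplex.single₀ D).map (G.map φ) ≫ (J.mapOfInjective G hJ).ι := by
  dsimp only [mapOfInjective]
  rw [assoc, ← Functor.map_comp, h, Functor.map_comp]
  exact ((HomologicalComplex.singleMapHomologicalComplex G _ 0).inv.naturality_assoc φ _).symm

/-- This is why arrows are resolved rather than objects: one lift in the arrow category makes both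
squares commute strictly, not merely up to homotopy, so connecting maps become natural. -/
lemma InjectiveResolution.exists_shortComplexResolution_map [EnoughInjectives C]
    {S S' : ShortComplex C} (φ : S ⟶ S') (hS : S.ShortExact) (hS' : S'.ShortExact)
    (I : InjectiveResolution (mk₁ S.g)) (I' : InjectiveResolution (mk₁ S'.g)) :
    ∃ (ψ₁ : (I.shortComplexResolution hS).I₁.cocomplex ⟶
        (I'.shortComplexResolution hS').I₁.cocomplex)
      (ψ₂ : (I.shortComplexResolution hS).I₂.cocomplex ⟶
        (I'.shortComplexResolution hS').I₂.cocomplex)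
      (ψ₃ : (I.shortComplexResolution hS).I₃.cocomplex ⟶
        (I'.shortComplexResolution hS').I₃.cocomplex),
      ψ₁ ≫ (I'.shortComplexResolution hS').f = (I.shortComplexResolution hS).f ≫ ψ₂ ∧
      ψ₂ ≫ (I'.shortComplexResolution hS').g = (I.shortComplexResolution hS).g ≫ ψ₃ ∧
      (I.shortComplexResolution hS).I₁.ι ≫ ψ₁ =
        (CochainComplex.single₀ C).map φ.τ₁ ≫ (I'.shortComplexResolution hS').I₁.ι ∧
      (I.shortComplexResolution hS).I₃.ι ≫ ψ₃ =
        (CochainComplex.single₀ C).map φ.τ₃ ≫ (I'.shortComplexResolution hS').I₃.ι := by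
  let f : mk₁ S.g ⟶ mk₁ S'.g := homMk₁ φ.τ₂ φ.τ₃ φ.comm₂₃.symm
  let ψ : I.cocomplex ⟶ I'.cocomplex := InjectiveResolution.desc f I' I
  have hψ := InjectiveResolution.desc_commutes f I' I
  let A := I.shortComplexResolution hS
  let A' := I'.shortComplexResolution hS'
  let ψ₁ : A.I₁.cocomplex ⟶ A'.I₁.cocomplex := (arrowComplexKernelMap ψ).τ₁
  let ψ₂ : A.I₂.cocomplex ⟶ A'.I₂.cocomplex := (arrowComplexKernelMap ψ).τ₂
  let ψ₃ : A.I₃.cocomplex ⟶ A'.I₃.cocomplex := (arrowComplexKernelMap ψ).τ₃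
  have h₁₂ : ψ₁ ≫ A'.f = A.f ≫ ψ₂ := (arrowComplexKernelMap ψ).comm₁₂
  have h₂₃ : ψ₂ ≫ A'.g = A.g ≫ ψ₃ := (arrowComplexKernelMap ψ).comm₂₃
  have h₃ : A.I₃.ι ≫ ψ₃ = (CochainComplex.single₀ C).map φ.τ₃ ≫ A'.I₃.ι :=
    I.mapOfInjective_ι_comp_map I' f ψ hψ ((evaluation (Fin 2) C).obj 1) _ _
  have h₂ : A.I₂.ι ≫ ψ₂ = (CochainComplex.single₀ C).map φ.τ₂ ≫ A'.I₂.ι :=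
    I.mapOfInjective_ι_comp_map I' f ψ hψ ((evaluation (Fin 2) C).obj 0) _ _
  refine ⟨ψ₁, ψ₂, ψ₃, h₁₂, h₂₃, ?_, h₃⟩
  -- Compatibility on the first term follows from that on the middle term, after composing with this
  -- monomorphism.
  have : Mono A'.f := (shortExact_arrowComplexKernel I'.cocomplex).mono_f
  rw [← cancel_mono A'.f]
  change (A.I₁.ι ≫ ψ₁) ≫ A'.f = ((CochainComplex.single₀ C).map φ.τ₁ ≫ A'.I₁.ι) ≫ A'.f
  rw [assoc, h₁₂, ← assoc, A.ι_f, assoc, h₂, assoc, A'.ι_f, ← Functor.map_comp_assoc,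
    ← Functor.map_comp_assoc, φ.comm₁₂]

end ShortExactResolution

/-! ### The long exact sequence of right derived functors. -/

section RightDerived

variable {C D : Type*} [Category* C] [Abelian C] [EnoughInjectives C] [Category* D] [Abelian D]
  (F : C ⥤ D) [F.Additive] {S S' : ShortComplex C}

lemma InjectiveResolution.rightDerived_map_comp_iso {X Y : C} {f : X ⟶ Y}
    {I : InjectiveResolution X} {J : InjectiveResolution Y} {φ : I.cocomplex ⟶ J.cocomplex}
    (h : I.ι ≫ φ = (CochainComplex.single₀ C).map f ≫ J.ι) (n : ℕ) :
    (F.rightDerived n).map f ≫ (J.isoRightDerivedObj F n).hom =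
      (I.isoRightDerivedObj F n).hom ≫ (HomologicalComplex.homologyFunctor _ _ n).map
        ((F.mapHomologicalComplex _).map φ) :=
  InjectiveResolution.isoRightDerivedObj_hom_naturality f I J φ (by
    have := congrArg (fun φ => φ.f 0) h
    simpa using this) F n

lemma Functor.rightDerived_map_zero (n : ℕ) (X Y : C) :
    (F.rightDerived n).map (0 : X ⟶ Y) = 0 := by
  rw [← cancel_mono ((injectiveResolution Y).isoRightDerivedObj F n).hom,
    InjectiveResolution.rightDerived_map_comp_iso F
      (I := injectiveResolution X) (J := injectiveResolution Y) (φ := 0) (by simp),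
    Functor.map_zero, Functor.map_zero, comp_zero, zero_comp]

namespace ShortComplexResolution

variable (A : ShortComplexResolution S)

/-- The image under an additive functor of a degreewise split resolution. -/
noncomputable def mapComplex : ShortComplex (CochainComplex D ℕ) :=
  ShortComplex.mk ((F.mapHomologicalComplex _).map A.f) ((F.mapHomologicalComplex _).map A.g)
    (by rw [← Functor.map_comp, A.w, Functor.map_zero])

-- Degreewise splitness is what survives an arbitrary additive functor.
omit [EnoughInjectives C] in
lemma shortExact_mapComplex : (A.mapComplex F).ShortExact :=
  HomologicalComplex.shortExact_of_degreewise_shortExact _ fun n =>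
    ((A.splitting n).some.map F).shortExact

/-- The connecting morphism on the cohomology of the image of a resolution. -/
noncomputable def δ (n : ℕ) :
    (HomologicalComplex.homologyFunctor D _ n).obj
      ((F.mapHomologicalComplex _).obj A.I₃.cocomplex) ⟶
    (HomologicalComplex.homologyFunctor D _ (n + 1)).obj
      ((F.mapHomologicalComplex _).obj A.I₁.cocomplex) :=
  (A.shortExact_mapComplex F).δ n (n + 1) rfl

/-- The connecting morphism on right derived functors. -/
noncomputable def derivedδ (n : ℕ) :
    (F.rightDerived n).obj S.X₃ ⟶ (F.rightDerived (n + 1)).obj S.X₁ :=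
  (A.I₃.isoRightDerivedObj F n).hom ≫ A.δ F n ≫ (A.I₁.isoRightDerivedObj F (n + 1)).inv

lemma derivedδ_comp_iso (n : ℕ) :
    A.derivedδ F n ≫ (A.I₁.isoRightDerivedObj F (n + 1)).hom =
      (A.I₃.isoRightDerivedObj F n).hom ≫ A.δ F n := by
  simp [derivedδ]

lemma comp_derivedδ (n : ℕ) : (F.rightDerived n).map S.g ≫ A.derivedδ F n = 0 := by
  have h : (HomologicalComplex.homologyFunctor D _ n).map ((F.mapHomologicalComplex _).map A.g) ≫
    A.δ F n = 0 := (A.shortExact_mapComplex F).comp_δ n (n + 1) rfl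
  rw [← cancel_mono (A.I₁.isoRightDerivedObj F (n + 1)).hom, assoc, derivedδ_comp_iso, ← assoc,
    InjectiveResolution.rightDerived_map_comp_iso F A.ι_g, assoc, h, comp_zero, zero_comp]

lemma derivedδ_comp (n : ℕ) : A.derivedδ F n ≫ (F.rightDerived (n + 1)).map S.f = 0 := by
  have h : A.δ F n ≫ (HomologicalComplex.homologyFunctor D _ (n + 1)).map
    ((F.mapHomologicalComplex _).map A.f) = 0 := (A.shortExact_mapComplex F).δ_comp n (n + 1) rfl
  rw [← cancel_mono (A.I₂.isoRightDerivedObj F (n + 1)).hom, assoc,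
    InjectiveResolution.rightDerived_map_comp_iso F A.ι_f, ← assoc, derivedδ_comp_iso, assoc, h,
    comp_zero, zero_comp]

include A in
lemma rightDerived_exact₂ (n : ℕ)
    (w : (F.rightDerived n).map S.f ≫ (F.rightDerived n).map S.g = 0) :
    (ShortComplex.mk ((F.rightDerived n).map S.f) ((F.rightDerived n).map S.g) w).Exact :=
  (ShortComplex.exact_iff_of_iso (ShortComplex.isoMk
    (A.I₁.isoRightDerivedObj F n) (A.I₂.isoRightDerivedObj F n) (A.I₃.isoRightDerivedObj F n)
    (InjectiveResolution.rightDerived_map_comp_iso F A.ι_f n).symm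
    (InjectiveResolution.rightDerived_map_comp_iso F A.ι_g n).symm)).2
    ((A.shortExact_mapComplex F).homology_exact₂ n)

lemma rightDerived_exact₃ (n : ℕ) : (ShortComplex.mk _ _ (A.comp_derivedδ F n)).Exact :=
  (ShortComplex.exact_iff_of_iso (ShortComplex.isoMk
    (A.I₂.isoRightDerivedObj F n) (A.I₃.isoRightDerivedObj F n) (A.I₁.isoRightDerivedObj F (n + 1))
    (InjectiveResolution.rightDerived_map_comp_iso F A.ι_g n).symm
    (A.derivedδ_comp_iso F n).symm)).2
    ((A.shortExact_mapComplex F).homology_exact₃ n (n + 1) rfl)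

lemma rightDerived_exact₁ (n : ℕ) : (ShortComplex.mk _ _ (A.derivedδ_comp F n)).Exact :=
  (ShortComplex.exact_iff_of_iso (ShortComplex.isoMk
    (A.I₃.isoRightDerivedObj F n) (A.I₁.isoRightDerivedObj F (n + 1))
    (A.I₂.isoRightDerivedObj F (n + 1))
    (A.derivedδ_comp_iso F n).symm
    (InjectiveResolution.rightDerived_map_comp_iso F A.ι_f (n + 1)).symm)).2
    ((A.shortExact_mapComplex F).homology_exact₁ n (n + 1) rfl)

omit [EnoughInjectives C] in
lemma δ_naturality {A : ShortComplexResolution S} {A' : ShortComplexResolution S'}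
    {ψ₁ : A.I₁.cocomplex ⟶ A'.I₁.cocomplex} {ψ₂ : A.I₂.cocomplex ⟶ A'.I₂.cocomplex}
    {ψ₃ : A.I₃.cocomplex ⟶ A'.I₃.cocomplex} (h₁₂ : ψ₁ ≫ A'.f = A.f ≫ ψ₂)
    (h₂₃ : ψ₂ ≫ A'.g = A.g ≫ ψ₃) (n : ℕ) :
    A.δ F n ≫ (HomologicalComplex.homologyFunctor _ _ (n + 1)).map
        ((F.mapHomologicalComplex _).map ψ₁) =
      (HomologicalComplex.homologyFunctor _ _ n).map ((F.mapHomologicalComplex _).map ψ₃) ≫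
        A'.δ F n :=
  HomologicalComplex.HomologySequence.δ_naturality
    { τ₁ := (F.mapHomologicalComplex _).map ψ₁
      τ₂ := (F.mapHomologicalComplex _).map ψ₂
      τ₃ := (F.mapHomologicalComplex _).map ψ₃
      comm₁₂ := by simp only [mapComplex, ← Functor.map_comp, h₁₂]
      comm₂₃ := by simp only [mapComplex, ← Functor.map_comp, h₂₃] }
    (A.shortExact_mapComplex F) (A'.shortExact_mapComplex F) n (n + 1) rfl

end ShortComplexResolution

namespace Functor

/-- The connecting morphism of right derived functors. -/
noncomputable def rightDerivedδ (hS : S.ShortExact) (n : ℕ) :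
    (F.rightDerived n).obj S.X₃ ⟶ (F.rightDerived (n + 1)).obj S.X₁ :=
  ((injectiveResolution (mk₁ S.g)).shortComplexResolution hS).derivedδ F n

lemma comp_rightDerivedδ (hS : S.ShortExact) (n : ℕ) :
    (F.rightDerived n).map S.g ≫ F.rightDerivedδ hS n = 0 :=
  ShortComplexResolution.comp_derivedδ F _ n

lemma rightDerivedδ_comp (hS : S.ShortExact) (n : ℕ) :
    F.rightDerivedδ hS n ≫ (F.rightDerived (n + 1)).map S.f = 0 :=
  ShortComplexResolution.derivedδ_comp F _ n

lemma rightDerived_exact₂ (hS : S.ShortExact) (n : ℕ)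
    (w : (F.rightDerived n).map S.f ≫ (F.rightDerived n).map S.g = 0) :
    (ShortComplex.mk ((F.rightDerived n).map S.f) ((F.rightDerived n).map S.g) w).Exact :=
  ShortComplexResolution.rightDerived_exact₂ F
    ((injectiveResolution (mk₁ S.g)).shortComplexResolution hS) n w

lemma rightDerived_exact₃ (hS : S.ShortExact) (n : ℕ) :
    (ShortComplex.mk _ _ (F.comp_rightDerivedδ hS n)).Exact :=
  ShortComplexResolution.rightDerived_exact₃ F _ n

lemma rightDerived_exact₁ (hS : S.ShortExact) (n : ℕ) :
    (ShortComplex.mk _ _ (F.rightDerivedδ_comp hS n)).Exact :=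
  ShortComplexResolution.rightDerived_exact₁ F _ n

lemma rightDerivedδ_naturality (φ : S ⟶ S') (hS : S.ShortExact) (hS' : S'.ShortExact) (n : ℕ) :
    F.rightDerivedδ hS n ≫ (F.rightDerived (n + 1)).map φ.τ₁ =
      (F.rightDerived n).map φ.τ₃ ≫ F.rightDerivedδ hS' n := by
  obtain ⟨ψ₁, ψ₂, ψ₃, h₁₂, h₂₃, h₁, h₃⟩ :=
    InjectiveResolution.exists_shortComplexResolution_map φ hS hS'
      (injectiveResolution (mk₁ S.g)) (injectiveResolution (mk₁ S'.g))
  dsimp only [rightDerivedδ]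
  rw [← cancel_mono (((injectiveResolution (mk₁ S'.g)).shortComplexResolution
      hS').I₁.isoRightDerivedObj F (n + 1)).hom, assoc, assoc,
    InjectiveResolution.rightDerived_map_comp_iso F h₁, ShortComplexResolution.derivedδ_comp_iso,
    ← assoc, ShortComplexResolution.derivedδ_comp_iso, assoc,
    ShortComplexResolution.δ_naturality F h₁₂ h₂₃, ← assoc, ← assoc,
    InjectiveResolution.rightDerived_map_comp_iso F h₃]

end Functor

end RightDerived

end CategoryTheory

namespace LocalCohomologySpec

variable {R : Type u} [CommRing R] (Φ : Set (PrimeSpectrum R))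

/-! ### Torsion modules. -/

section Torsion

variable {Φ} {M N : Type u} [AddCommGroup M] [Module R M] [AddCommGroup N] [Module R N]

lemma mem_torsionSubmodule_iff {x : M} :
    x ∈ torsionSubmodule Φ M ↔ ∀ p ∉ Φ, ∃ r ∉ p.asIdeal, r • x = 0 := by
  constructor
  · intro hx p hp
    have hn : p ∉ Module.support R (Submodule.span R {x}) := fun h => hp (hx h)
    obtain ⟨r, hr, h⟩ := Module.notMem_support_iff'.mp hn
      ⟨x, Submodule.mem_span_singleton_self x⟩
    exact ⟨r, hr, congrArg Subtype.val h⟩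
  · intro h p hp
    by_contra hpΦ
    obtain ⟨r, hr, hrx⟩ := h p hpΦ
    refine Module.notMem_support_iff'.mpr ?_ hp
    rintro ⟨m, hm⟩
    obtain ⟨a, rfl⟩ := Submodule.mem_span_singleton.mp hm
    refine ⟨r, hr, Subtype.ext ?_⟩
    change r • a • x = 0
    rw [smul_comm, hrx, smul_zero]

variable (Φ M) in
/-- A module is `Φ`-torsion if it equals its `Φ`-torsion submodule. -/
def IsTorsion : Prop := torsionSubmodule Φ M = ⊤

lemma IsTorsion.mem (h : IsTorsion Φ M) (x : M) : x ∈ torsionSubmodule Φ M :=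
  h.symm ▸ Submodule.mem_top

lemma mem_torsionSubmodule_map_iff {f : M →ₗ[R] N} (hf : Function.Injective f) {x : M} :
    f x ∈ torsionSubmodule Φ N ↔ x ∈ torsionSubmodule Φ M := by
  simp_rw [mem_torsionSubmodule_iff, ← map_smul, map_eq_zero_iff f hf]

lemma IsTorsion.of_injective {f : M →ₗ[R] N} (hf : Function.Injective f) (h : IsTorsion Φ N) :
    IsTorsion Φ M :=
  eq_top_iff.2 fun x _ => (mem_torsionSubmodule_map_iff hf).1 (h.mem (f x))

lemma IsTorsion.of_surjective {f : M →ₗ[R] N} (hf : Function.Surjective f) (h : IsTorsion Φ M) :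
    IsTorsion Φ N :=
  eq_top_iff.2 fun y _ => by
    obtain ⟨x, rfl⟩ := hf y
    exact map_mem_torsionSubmodule Φ f (h.mem x)

lemma isTorsion_torsionSubmodule : IsTorsion Φ (torsionSubmodule Φ M) :=
  eq_top_iff.2 fun x _ =>
    (mem_torsionSubmodule_map_iff (torsionSubmodule Φ M).subtype_injective).1 x.2

/-- Torsion is closed under extensions: multiply an annihilator modulo N by an annihilator inside N.
-/
lemma mem_torsionSubmodule_of_mkQ {N : Submodule R M} (hN : IsTorsion Φ N) {x : M}
    (hx : N.mkQ x ∈ torsionSubmodule Φ (M ⧸ N)) : x ∈ torsionSubmodule Φ M := by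
  rw [mem_torsionSubmodule_iff] at hx ⊢
  intro p hp
  obtain ⟨r, hr, h⟩ := hx p hp
  rw [← map_smul, Submodule.mkQ_apply, Submodule.Quotient.mk_eq_zero] at h
  obtain ⟨s, hs, h'⟩ := mem_torsionSubmodule_iff.1 (hN.mem ⟨r • x, h⟩) p hp
  refine ⟨s * r, p.asIdeal.primeCompl.mul_mem hs hr, ?_⟩
  rw [mul_smul]
  exact congrArg Subtype.val h'

lemma torsionSubmodule_quotient_eq_bot : torsionSubmodule Φ (M ⧸ torsionSubmodule Φ M) = ⊥ := by
  refine eq_bot_iff.2 fun y hy => ?_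
  obtain ⟨x, rfl⟩ := Submodule.mkQ_surjective _ y
  simpa using mem_torsionSubmodule_of_mkQ isTorsion_torsionSubmodule hy

end Torsion

/-! ### Local cohomology as a δ-functor on modules. -/

section Cohomology

instance : Limits.PreservesFiniteLimits (torsionFunctor Φ) := by
  refine ((Functor.preservesFiniteLimits_tfae (torsionFunctor Φ)).out 0 3).1 ?_
  intro S hS
  have hf : Function.Injective S.f.hom := (ModuleCat.mono_iff_injective _).1 hS.mono_f
  have hfg : Function.Exact S.f.hom S.g.hom :=
    (ShortComplex.ShortExact.moduleCat_exact_iff_function_exact S).1 hS.exact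
  refine ⟨(ShortComplex.ShortExact.moduleCat_exact_iff_function_exact _).2 ?_,
    (ModuleCat.mono_iff_injective _).2 fun x y h => Subtype.ext (hf (congrArg Subtype.val h))⟩
  intro y
  constructor
  · intro h
    obtain ⟨x, hx⟩ := (hfg y.1).1 (congrArg Subtype.val h)
    exact ⟨⟨x, (mem_torsionSubmodule_map_iff hf).1 (hx ▸ y.2)⟩, Subtype.ext hx⟩
  · rintro ⟨x, rfl⟩
    exact Subtype.ext ((hfg _).2 ⟨x.1, rfl⟩)

variable {A B C A' B' C' : Type u} [AddCommGroup A] [Module R A] [AddCommGroup B] [Module R B]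
  [AddCommGroup C] [Module R C] [AddCommGroup A'] [Module R A'] [AddCommGroup B'] [Module R B']
  [AddCommGroup C'] [Module R C']

variable (A) in
/-- The `n`-th local cohomology module of an unbundled module. -/
noncomputable abbrev LocalCohomology (n : ℕ) : Type u :=
  (localCohomologyFunctor Φ n).obj (ModuleCat.of R A)

namespace LocalCohomology

/-- The map induced on local cohomology by a linear map. -/
noncomputable def map (n : ℕ) (f : A →ₗ[R] B) :
    LocalCohomology Φ A n →ₗ[R] LocalCohomology Φ B n :=
  ((localCohomologyFunctor Φ n).map (ModuleCat.ofHom f)).hom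

@[simp]
lemma map_id (n : ℕ) : map Φ n (LinearMap.id : A →ₗ[R] A) = LinearMap.id :=
  congrArg ModuleCat.Hom.hom ((localCohomologyFunctor Φ n).map_id (ModuleCat.of R A))

lemma map_comp (n : ℕ) (g : B →ₗ[R] C) (f : A →ₗ[R] B) :
    map Φ n (g ∘ₗ f) = map Φ n g ∘ₗ map Φ n f :=
  congrArg ModuleCat.Hom.hom
    ((localCohomologyFunctor Φ n).map_comp (ModuleCat.ofHom f) (ModuleCat.ofHom g))

lemma map_zero (n : ℕ) : map Φ n (0 : A →ₗ[R] B) = 0 :=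
  congrArg ModuleCat.Hom.hom
    ((torsionFunctor Φ).rightDerived_map_zero n (ModuleCat.of R A) (ModuleCat.of R B))

/-- Linear equivalences induce linear equivalences on local cohomology. -/
noncomputable def congr (n : ℕ) (e : A ≃ₗ[R] B) :
    LocalCohomology Φ A n ≃ₗ[R] LocalCohomology Φ B n :=
  LinearEquiv.ofLinearMap (map Φ n e.toLinearMap) (map Φ n e.symm.toLinearMap)
    (by rw [← map_comp]; simp) (by rw [← map_comp]; simp)

/-- The zeroth local cohomology is the torsion submodule. -/
noncomputable def zeroEquiv : LocalCohomology Φ A 0 ≃ₗ[R] torsionSubmodule Φ A :=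
  ((torsionFunctor Φ).rightDerivedZeroIsoSelf.app (ModuleCat.of R A)).toLinearEquiv

lemma zeroEquiv_map (f : A →ₗ[R] B) (x : LocalCohomology Φ A 0) :
    (zeroEquiv Φ (map Φ 0 f x) : B) = f (zeroEquiv Φ x) :=
  congrArg Subtype.val (congrArg (fun φ => φ.hom x)
    ((torsionFunctor Φ).rightDerivedZeroIsoSelf.hom.naturality (ModuleCat.ofHom f)))

variable {f : A →ₗ[R] B} {g : B →ₗ[R] C} {f' : A' →ₗ[R] B'} {g' : B' →ₗ[R] C'}

/-- The short complex of modules attached to an exact pair of maps. -/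
abbrev shortComplex (hfg : Function.Exact f g) : ShortComplex (ModuleCat.{u} R) :=
  ShortComplex.mk (ModuleCat.ofHom f) (ModuleCat.ofHom g)
    (by ext x; exact hfg.apply_apply_eq_zero x)

lemma shortExact (hf : Function.Injective f) (hg : Function.Surjective g)
    (hfg : Function.Exact f g) : (shortComplex hfg).ShortExact where
  exact := (ShortComplex.ShortExact.moduleCat_exact_iff_function_exact _).2 hfg
  mono_f := (ModuleCat.mono_iff_injective _).2 hf
  epi_g := (ModuleCat.epi_iff_surjective _).2 hg

/-- The connecting homomorphism of local cohomology. -/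
noncomputable def δ (hf : Function.Injective f) (hg : Function.Surjective g)
    (hfg : Function.Exact f g) (n : ℕ) :
    LocalCohomology Φ C n →ₗ[R] LocalCohomology Φ A (n + 1) :=
  ((torsionFunctor Φ).rightDerivedδ (shortExact hf hg hfg) n).hom

section

variable (hf : Function.Injective f) (hg : Function.Surjective g) (hfg : Function.Exact f g) (n : ℕ)

include hf hg hfg in
lemma exact_map_map : Function.Exact (map Φ n f) (map Φ n g) := by
  have w : map Φ n g ∘ₗ map Φ n f = 0 := by
    rw [← map_comp, hfg.linearMap_comp_eq_zero, map_zero]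
  exact (ShortComplex.ShortExact.moduleCat_exact_iff_function_exact _).1
    ((torsionFunctor Φ).rightDerived_exact₂ (shortExact hf hg hfg) n
      (ModuleCat.hom_ext w))

lemma exact_map_δ : Function.Exact (map Φ n g) (δ Φ hf hg hfg n) :=
  (ShortComplex.ShortExact.moduleCat_exact_iff_function_exact _).1
    ((torsionFunctor Φ).rightDerived_exact₃ (shortExact hf hg hfg) n)

lemma exact_δ_map : Function.Exact (δ Φ hf hg hfg n) (map Φ (n + 1) f) :=
  (ShortComplex.ShortExact.moduleCat_exact_iff_function_exact _).1
    ((torsionFunctor Φ).rightDerived_exact₁ (shortExact hf hg hfg) n)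

lemma δ_naturality {hf : Function.Injective f} {hg : Function.Surjective g}
    {hfg : Function.Exact f g} (hf' : Function.Injective f') (hg' : Function.Surjective g')
    (hfg' : Function.Exact f' g') {a : A →ₗ[R] A'} {b : B →ₗ[R] B'} {c : C →ₗ[R] C'}
    (h₁ : f' ∘ₗ a = b ∘ₗ f) (h₂ : g' ∘ₗ b = c ∘ₗ g) (x : LocalCohomology Φ C n) :
    map Φ (n + 1) a (δ Φ hf hg hfg n x) = δ Φ hf' hg' hfg' n (map Φ n c x) :=
  congrArg (fun φ => φ.hom x) ((torsionFunctor Φ).rightDerivedδ_naturality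
    (S := shortComplex hfg) (S' := shortComplex hfg')
    { τ₁ := ModuleCat.ofHom a
      τ₂ := ModuleCat.ofHom b
      τ₃ := ModuleCat.ofHom c
      comm₁₂ := by ext y; exact congrArg (fun φ => φ y) h₁
      comm₂₃ := by ext y; exact congrArg (fun φ => φ y) h₂ }
    (shortExact hf hg hfg) (shortExact hf' hg' hfg') n)

lemma subsingleton_of_injective [Module.Injective R A] :
    Subsingleton (LocalCohomology Φ A (n + 1)) := by
  have : Injective (ModuleCat.of R A) :=
    (Module.injective_iff_injective_object R A).1 inferInstance
  exact ModuleCat.subsingleton_of_isZero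
    ((torsionFunctor Φ).isZero_rightDerived_obj_injective_succ n (ModuleCat.of R A))

end

variable (R A) in
lemma _root_.Module.exists_injective_embedding :
    ∃ (E : Type u) (_ : AddCommGroup E) (_ : Module R E) (i : A →ₗ[R] E),
      Module.Injective R E ∧ Function.Injective i := by
  let E := Injective.under (ModuleCat.of R A)
  refine ⟨E, inferInstance, inferInstance, (Injective.ι (ModuleCat.of R A)).hom, ?_,
    (ModuleCat.mono_iff_injective _).1 inferInstance⟩
  exact (Module.injective_iff_injective_object R E).2 (inferInstanceAs (Injective E))

variable (R A) in
/-- Dimension shifting. -/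
lemma exists_surjective_δ :
    ∃ (E C : Type u) (_ : AddCommGroup E) (_ : Module R E) (_ : AddCommGroup C) (_ : Module R C)
      (f : A →ₗ[R] E) (g : E →ₗ[R] C) (hf : Function.Injective f) (hg : Function.Surjective g)
      (hfg : Function.Exact f g), ∀ n, Function.Surjective (δ Φ hf hg hfg n) := by
  obtain ⟨E, _, _, i, _, hi⟩ := Module.exists_injective_embedding R A
  refine ⟨E, E ⧸ LinearMap.range i, inferInstance, inferInstance, inferInstance, inferInstance,
    i, (LinearMap.range i).mkQ, hi, Submodule.mkQ_surjective _, LinearMap.exact_map_mkQ_range i,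
    fun n y => ?_⟩
  have := subsingleton_of_injective Φ n (A := E)
  exact (exact_δ_map Φ _ _ _ n y).1 (Subsingleton.elim _ _)

/-- Clear in degree zero; it climbs by dimension shifting because connecting maps are linear and
natural for scalar endomorphisms. -/
lemma map_smul_id (n : ℕ) (r : R) (x : LocalCohomology Φ A n) :
    map Φ n (r • LinearMap.id : A →ₗ[R] A) x = r • x := by
  induction n generalizing A with
  | zero =>
    apply (zeroEquiv Φ).injective
    apply Subtype.ext
    rw [zeroEquiv_map, map_smul]
    rfl
  | succ n ih =>
    obtain ⟨E, C, _, _, _, _, f, g, hf, hg, hfg, hδ⟩ := exists_surjective_δ R Φ A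
    obtain ⟨y, rfl⟩ := hδ n x
    rw [δ_naturality Φ n hf hg hfg (b := r • LinearMap.id) (c := r • LinearMap.id)
      (by ext; simp) (by ext; simp), ih, map_smul]

lemma isTorsion (n : ℕ) : IsTorsion Φ (LocalCohomology Φ A n) := by
  induction n generalizing A with
  | zero => exact isTorsion_torsionSubmodule.of_injective (zeroEquiv Φ).injective
  | succ n ih =>
    obtain ⟨E, C, _, _, _, _, f, g, hf, hg, hfg, hδ⟩ := exists_surjective_δ R Φ A
    exact ih.of_surjective (hδ n)

/-- Local cohomology is effaced by finite modules. -/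
lemma exists_finite_map_eq [IsNoetherianRing R] (n : ℕ) (x : LocalCohomology Φ A n) :
    ∃ (S : Type u) (_ : AddCommGroup S) (_ : Module R S) (_ : Module.Finite R S) (φ : S →ₗ[R] A)
      (y : LocalCohomology Φ S n), map Φ n φ y = x := by
  induction n generalizing A with
  | zero =>
    let a : A := zeroEquiv Φ x
    have ha : (⟨a, Submodule.mem_span_singleton_self a⟩ : Submodule.span R {a}) ∈
        torsionSubmodule Φ (Submodule.span R {a}) :=
      (mem_torsionSubmodule_map_iff (Submodule.span R {a}).subtype_injective).1
        (zeroEquiv Φ x).2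
    refine ⟨Submodule.span R {a}, inferInstance, inferInstance, inferInstance,
      (Submodule.span R {a}).subtype, (zeroEquiv Φ).symm ⟨_, ha⟩, ?_⟩
    apply (zeroEquiv Φ).injective
    apply Subtype.ext
    rw [zeroEquiv_map, LinearEquiv.apply_symm_apply]
    rfl
  | succ n ih =>
    obtain ⟨E, C, _, _, _, _, f, g, hf, hg, hfg, hδ⟩ := exists_surjective_δ R Φ A
    obtain ⟨c, rfl⟩ := hδ n x
    obtain ⟨S, _, _, _, φ, y, rfl⟩ := ih c
    -- Cover S by a finite free module and lift to E. The lift sends the kernel of the cover, finite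
    -- since R is noetherian, into A, and naturality of δ carries the class there.
    obtain ⟨k, p, hp⟩ := Module.Finite.exists_fin' R S
    obtain ⟨b, hb⟩ := Module.projective_lifting_property g (φ ∘ₗ p) hg
    have hb' : ∀ z, g (b z) = φ (p z) := fun z => congrArg (fun φ => φ z) hb
    have hr : ∀ z : LinearMap.ker p, b z ∈ LinearMap.range f := fun z =>
      (hfg _).1 (by rw [hb', z.2, _root_.map_zero])
    let e := LinearEquiv.ofInjective f hf
    let a : LinearMap.ker p →ₗ[R] A :=
      e.symm.toLinearMap ∘ₗ (b ∘ₗ (LinearMap.ker p).subtype).codRestrict _ hr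
    have ha : f ∘ₗ a = b ∘ₗ (LinearMap.ker p).subtype := by
      ext z
      exact congrArg Subtype.val (e.apply_symm_apply ⟨b z, hr z⟩)
    exact ⟨LinearMap.ker p, inferInstance, inferInstance, inferInstance, a,
      δ Φ (LinearMap.ker p).subtype_injective hp (LinearMap.exact_subtype_ker_map p) n y,
      δ_naturality Φ n hf hg hfg ha hb y⟩

end LocalCohomology

end Cohomology

end LocalCohomologySpec

/-! ### Torsion in injective modules, and acyclicity of torsion modules. -/

namespace LocalCohomologySpec

open scoped Pointwise

section

variable {R : Type u} [CommRing R] {Φ : Set (PrimeSpectrum R)}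
  {M : Type u} [AddCommGroup M] [Module R M]

lemma IsTorsion.support_subset (h : IsTorsion Φ M) : Module.support R M ⊆ Φ := by
  intro p hp
  obtain ⟨m, hm⟩ := Module.mem_support_iff'.mp hp
  by_contra hpΦ
  obtain ⟨r, hr, h0⟩ := mem_torsionSubmodule_iff.1 (h.mem m) p hpΦ
  exact hm r hr h0

lemma isTorsion_iff_support_subset : IsTorsion Φ M ↔ Module.support R M ⊆ Φ := by
  refine ⟨IsTorsion.support_subset, fun h => eq_top_iff.2 fun x _ => ?_⟩
  exact (Module.support_subset_of_injective (Submodule.span R {x}).subtype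
    (Submodule.subtype_injective _)).trans h

variable [IsNoetherianRing R]

variable (Φ) in
/-- Over a noetherian ring the torsion submodule of an injective module is injective. -/
lemma injective_torsionSubmodule [Module.Injective R M] :
    Module.Injective R (torsionSubmodule Φ M) := by
  apply Module.Baer.injective
  intro I g
  let J := Module.annihilator R (LinearMap.range g)
  -- The image of `g` is finite, so its support is the whole zero locus of its annihilator.
  have hJΦ : PrimeSpectrum.zeroLocus (J : Set R) ⊆ Φ := by
    rw [← Module.support_eq_zeroLocus]
    exact (isTorsion_torsionSubmodule.of_injective
      (LinearMap.range g).subtype_injective).support_subset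
  obtain ⟨k, hk⟩ := Ideal.exists_pow_inf_eq_pow_smul J I
  let J' := J ^ (k + 1)
  -- By Artin–Rees, J^(k+1) ∩ I lies in J·I, which `g` kills. So `g` factors through the image of I
  -- in R/J^(k+1) and extends to that quotient with values in M.
  have hJ' : J' ⊓ I ≤ (LinearMap.ker g).map I.subtype := by
    have h := hk (k + 1) (by lia)
    rw [Nat.add_sub_cancel_left, pow_one, smul_eq_mul, Ideal.mul_top] at h
    rw [h]
    refine (smul_mono_right J inf_le_right).trans (Submodule.smul_le.2 ?_)
    intro r hr x hx
    refine ⟨r • ⟨x, hx⟩, ?_, rfl⟩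
    have := Module.mem_annihilator.1 hr ⟨g ⟨x, hx⟩, LinearMap.mem_range_self _ _⟩
    change g (r • ⟨x, hx⟩) = 0
    rw [map_smul]
    exact congrArg Subtype.val this
  let q : I →ₗ[R] R ⧸ J' := J'.mkQ ∘ₗ I.subtype
  have hq : LinearMap.ker q ≤ LinearMap.ker ((torsionSubmodule Φ M).subtype ∘ₗ g) := by
    intro x hx
    have hx' : (x : R) ∈ J' := (Submodule.Quotient.mk_eq_zero J').1 hx
    obtain ⟨y, hy, hyx⟩ := hJ' ⟨hx', x.2⟩
    obtain rfl : y = x := Subtype.ext hyx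
    have hy0 : g y = 0 := hy
    simp [hy0]
  obtain ⟨h, hh⟩ := Module.Injective.out ((LinearMap.ker q).liftQ q le_rfl)
    (LinearMap.ker_eq_bot.1 (Submodule.ker_liftQ_eq_bot' _ q rfl))
    ((LinearMap.ker q).liftQ _ hq)
  have hh' (x : I) : h (J'.mkQ x) = g x := hh ((LinearMap.ker q).mkQ x)
  -- The extension still takes torsion values, since the image of 1 is killed by a power of J.
  have he : h (J'.mkQ 1) ∈ torsionSubmodule Φ M := by
    refine mem_torsionSubmodule_iff.2 fun p hp => ?_
    have : ¬ J ≤ p.asIdeal := fun hle => hp (hJΦ hle)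
    obtain ⟨r, hrJ, hr⟩ := SetLike.not_le_iff_exists.1 this
    refine ⟨r ^ (k + 1), fun hr' => hr (p.isPrime.mem_of_pow_mem _ hr'), ?_⟩
    rw [← map_smul, ← map_smul]
    have : J'.mkQ (r ^ (k + 1) • 1) = 0 :=
      (Submodule.Quotient.mk_eq_zero J').2 (by simpa using Ideal.pow_mem_pow hrJ (k + 1))
    rw [this, map_zero]
  refine ⟨LinearMap.toSpanSingleton R _ ⟨_, he⟩, fun x hx => Subtype.ext ?_⟩
  rw [← hh' ⟨x, hx⟩]
  change x • h (J'.mkQ 1) = h (J'.mkQ x)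
  rw [← map_smul, ← map_smul, smul_eq_mul, mul_one]

namespace LocalCohomology

/-- M embeds in the torsion part of an injective module, which is again injective. The cokernel is
torsion too, so dimension shifting recurses; in degree one, taking torsion changes nothing, so the
surjection onto the cokernel remains surjective. -/
lemma subsingleton_of_isTorsion {M : Type u} [AddCommGroup M] [Module R M]
    (hM : IsTorsion Φ M) (n : ℕ) : Subsingleton (LocalCohomology Φ M (n + 1)) := by
  obtain ⟨E, _, _, i, _, hi⟩ := Module.exists_injective_embedding R M
  have := injective_torsionSubmodule Φ (M := E)
  let j : M →ₗ[R] torsionSubmodule Φ E :=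
    i.codRestrict _ fun x => map_mem_torsionSubmodule Φ i (hM.mem x)
  have hj : Function.Injective j := fun x y h => hi (congrArg Subtype.val h)
  have hg := Submodule.mkQ_surjective (LinearMap.range j)
  have hjg := LinearMap.exact_map_mkQ_range j
  have hC : IsTorsion Φ (torsionSubmodule Φ E ⧸ LinearMap.range j) :=
    isTorsion_torsionSubmodule.of_surjective hg
  refine subsingleton_of_forall_eq 0 fun x => ?_
  have := subsingleton_of_injective Φ n (A := torsionSubmodule Φ E)
  obtain ⟨c, rfl⟩ := (exact_δ_map Φ hj hg hjg n x).1 (Subsingleton.elim _ _)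
  cases n with
  | zero =>
    obtain ⟨e, he⟩ := hg (zeroEquiv Φ c)
    have hce : map Φ 0 (LinearMap.range j).mkQ
        ((zeroEquiv Φ).symm ⟨e, isTorsion_torsionSubmodule.mem e⟩) = c := by
      apply (zeroEquiv Φ).injective
      apply Subtype.ext
      rw [zeroEquiv_map, LinearEquiv.apply_symm_apply, he]
    exact (exact_map_δ Φ hj hg hjg 0 c).2 ⟨_, hce⟩
  | succ n =>
    have := subsingleton_of_isTorsion hC n
    rw [Subsingleton.elim c 0, _root_.map_zero]

end LocalCohomology

end

end LocalCohomologySpec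

/-! ### Regular elements and quotients by torsion. -/

namespace LocalCohomologySpec

open scoped Pointwise

section

variable {R : Type u} [CommRing R] {Φ : Set (PrimeSpectrum R)}
  {M : Type u} [AddCommGroup M] [Module R M]

namespace LocalCohomology

section Regular

variable {r : R} (hr : IsSMulRegular M r) (n : ℕ)

include hr in
lemma injective_smul_id : Function.Injective (r • LinearMap.id : M →ₗ[R] M) := hr

lemma exact_smul_id_mkQ (r : R) : Function.Exact (r • LinearMap.id : M →ₗ[R] M)
    (r • (⊤ : Submodule R M)).mkQ := by
  intro x
  rw [Submodule.mkQ_apply, Submodule.Quotient.mk_eq_zero, Submodule.mem_smul_pointwise_iff_exists]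
  exact ⟨fun ⟨y, _, hy⟩ => ⟨y, hy⟩, fun ⟨y, hy⟩ => ⟨y, trivial, hy⟩⟩

variable (Φ) in
/-- The connecting homomorphism of multiplication by a regular element. -/
noncomputable def regularδ :
    LocalCohomology Φ (QuotSMulTop r M) n →ₗ[R] LocalCohomology Φ M (n + 1) :=
  δ Φ (injective_smul_id hr) (Submodule.mkQ_surjective _) (exact_smul_id_mkQ r) n

lemma mem_range_regularδ_iff {x : LocalCohomology Φ M (n + 1)} :
    x ∈ LinearMap.range (regularδ Φ hr n) ↔ r • x = 0 := by
  rw [← map_smul_id Φ (n + 1) r x]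
  exact (exact_δ_map Φ (injective_smul_id hr) (Submodule.mkQ_surjective _)
    (exact_smul_id_mkQ r) n x).symm

lemma mem_range_map_mkQ_iff {x : LocalCohomology Φ (QuotSMulTop r M) n} :
    x ∈ LinearMap.range (map Φ n (r • (⊤ : Submodule R M)).mkQ) ↔ regularδ Φ hr n x = 0 :=
  (exact_map_δ Φ (injective_smul_id hr) (Submodule.mkQ_surjective _)
    (exact_smul_id_mkQ r) n x).symm

include hr in
lemma map_mkQ_eq_zero_iff {x : LocalCohomology Φ M n} :
    map Φ n (r • (⊤ : Submodule R M)).mkQ x = 0 ↔ ∃ y, r • y = x := by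
  rw [exact_map_map Φ (injective_smul_id hr) (Submodule.mkQ_surjective _)
    (exact_smul_id_mkQ r) n x]
  exact exists_congr fun y => by rw [map_smul_id]

end Regular

section Quotient

variable [IsNoetherianRing R] (n : ℕ)

/-- Torsion is acyclic, so dividing it out does not affect cohomology in positive degrees. -/
lemma injective_map_mkQ_torsionSubmodule :
    Function.Injective (map Φ (n + 1) (torsionSubmodule Φ M).mkQ) := by
  rw [injective_iff_map_eq_zero]
  intro x hx
  have := subsingleton_of_isTorsion (isTorsion_torsionSubmodule (Φ := Φ) (M := M)) n
  obtain ⟨y, rfl⟩ := (exact_map_map Φ (torsionSubmodule Φ M).subtype_injective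
    (Submodule.mkQ_surjective _) (LinearMap.exact_subtype_mkQ _) (n + 1) x).1 hx
  rw [Subsingleton.elim y 0, _root_.map_zero]

lemma surjective_map_mkQ_torsionSubmodule :
    Function.Surjective (map Φ n (torsionSubmodule Φ M).mkQ) := by
  intro x
  have := subsingleton_of_isTorsion (isTorsion_torsionSubmodule (Φ := Φ) (M := M)) n
  exact (exact_map_δ Φ (torsionSubmodule Φ M).subtype_injective
    (Submodule.mkQ_surjective _) (LinearMap.exact_subtype_mkQ _) n x).1 (Subsingleton.elim _ _)

end Quotient

/-! ### Vanishing above the dimension. -/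

section Vanishing

variable [IsNoetherianRing R]

omit [IsNoetherianRing R] in
lemma isTorsion_quotient_of_isMaximal (p : Ideal R) [p.IsMaximal] :
    IsTorsion (maxSpec R) (R ⧸ p) := by
  rw [isTorsion_iff_support_subset, Module.support_eq_zeroLocus, Ideal.annihilator_quotient]
  intro q hq
  have : p = q.asIdeal := Ideal.IsMaximal.eq_of_le inferInstance q.isPrime.ne_top hq
  change q.asIdeal.IsMaximal
  rwa [← this]

/-- Vanishing above the dimension of the support, for finite modules. -/
theorem subsingleton_of_supportDim_le {d i : ℕ} (hdi : d < i) {M : Type u} [AddCommGroup M]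
    [Module R M] [Module.Finite R M] (hM : Module.supportDim R M ≤ d) :
    Subsingleton (LocalCohomology (maxSpec R) M i) := by
  induction d generalizing i M with
  | zero =>
    obtain ⟨i, rfl⟩ := Nat.exists_eq_add_one_of_ne_zero (Nat.ne_zero_of_lt hdi)
    refine subsingleton_of_isTorsion ?_ i
    rw [isTorsion_iff_support_subset]
    intro p hp
    by_contra hmax
    obtain ⟨q, hq, hpq⟩ := Ideal.exists_le_maximal p.asIdeal p.isPrime.ne_top
    have hlt : p < ⟨q, hq.isPrime⟩ := lt_of_le_of_ne hpq fun h => hmax (by rw [h]; exact hq)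
    have hqM : (⟨q, hq.isPrime⟩ : PrimeSpectrum R) ∈ Module.support R M :=
      Module.mem_support_mono hpq hp
    have h1 : 1 ≤ Module.supportDim R M :=
      Order.one_le_krullDim_iff.2 ⟨⟨p, hp⟩, ⟨_, hqM⟩, hlt⟩
    exact absurd (h1.trans hM) (by norm_num)
  | succ d ih =>
    obtain ⟨i, rfl⟩ := Nat.exists_eq_add_one_of_ne_zero (Nat.ne_zero_of_lt hdi)
    revert hM
    -- The dimension bound belongs in the motive because it passes to submodules and quotients in
    -- the filtration.
    refine IsNoetherianRing.induction_on_isQuotientEquivQuotientPrime R (M := M) inferInstance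
      (motive := fun N _ _ _ => Module.supportDim R N ≤ ((d + 1 : ℕ) : WithBot ℕ∞) →
        Subsingleton (LocalCohomology (maxSpec R) N (i + 1))) ?_ ?_ ?_
    · intro N _ _ _ _ _
      refine subsingleton_of_isTorsion ?_ i
      exact eq_top_iff.2 fun x _ => by rw [Subsingleton.elim x 0]; exact zero_mem _
    · intro N _ _ _ p e hN
      rw [Module.supportDim_eq_of_equiv e] at hN
      suffices Subsingleton (LocalCohomology (maxSpec R) (R ⧸ p.asIdeal) (i + 1)) from
        (congr (maxSpec R) (i + 1) e).toEquiv.subsingleton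
      by_cases hp : p ∈ maxSpec R
      · have : p.asIdeal.IsMaximal := hp
        exact subsingleton_of_isTorsion (isTorsion_quotient_of_isMaximal p.asIdeal) i
      · refine subsingleton_of_forall_eq 0 fun x => ?_
        -- Cohomology is itself torsion, so as p is not maximal each class `x` is killed by some `r`
        -- outside p, depending on `x`. Being regular on R/p, `r` lowers the dimension.
        obtain ⟨r, hrp, hrx⟩ := mem_torsionSubmodule_iff.1
          ((isTorsion (maxSpec R) (A := R ⧸ p.asIdeal) (i + 1)).mem x) p hp
        have hr : IsSMulRegular (R ⧸ p.asIdeal) r := by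
          rw [isSMulRegular_iff_right_eq_zero_of_smul]
          intro y hy
          obtain ⟨y, rfl⟩ := Ideal.Quotient.mk_surjective y
          have : r * y ∈ p.asIdeal := Ideal.Quotient.eq_zero_iff_mem.1 hy
          exact Ideal.Quotient.eq_zero_iff_mem.2
            ((p.isPrime.mem_or_mem this).resolve_left hrp)
        have hdim := Module.supportDim_quotSMulTop_succ_le_of_notMem_minimalPrimes
          (M := R ⧸ p.asIdeal) (x := r) (by
            rw [Ideal.annihilator_quotient, Ideal.minimalPrimes_eq_subsingleton_self]
            rintro q rfl
            exact hrp)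
        have := ih (Nat.lt_of_succ_lt_succ hdi) (M := QuotSMulTop r (R ⧸ p.asIdeal)) (by
          have := hdim.trans hN
          rw [Nat.cast_add, Nat.cast_one] at this
          exact ENat.WithBot.add_le_add_one_right_iff.1 this)
        obtain ⟨y, rfl⟩ := (mem_range_regularδ_iff hr i).2 hrx
        rw [Subsingleton.elim y 0, _root_.map_zero]
    · intro N₁ _ _ _ N₂ _ _ _ N₃ _ _ _ f g hf hg hfg h₁ h₃ h
      have := h₁ ((Module.supportDim_le_of_injective f hf).trans h)
      have := h₃ ((Module.supportDim_le_of_surjective g hg).trans h)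
      refine subsingleton_of_forall_eq 0 fun x => ?_
      obtain ⟨y, rfl⟩ := (exact_map_map (maxSpec R) hf hg hfg (i + 1) x).1 (Subsingleton.elim _ _)
      rw [Subsingleton.elim y 0, _root_.map_zero]

/-- Vanishing above the dimension of the ring. -/
theorem subsingleton_of_ringKrullDim_le {d i : ℕ} (hdi : d < i) (hR : ringKrullDim R ≤ d)
    (M : Type u) [AddCommGroup M] [Module R M] :
    Subsingleton (LocalCohomology (maxSpec R) M i) := by
  refine subsingleton_of_forall_eq 0 fun x => ?_
  obtain ⟨S, _, _, _, φ, y, rfl⟩ := exists_finite_map_eq (maxSpec R) i x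
  have := subsingleton_of_supportDim_le hdi ((Module.supportDim_le_ringKrullDim R S).trans hR)
  rw [Subsingleton.elim y 0, _root_.map_zero]

end Vanishing

end LocalCohomology

end

end LocalCohomologySpec

/-! ### Artinian modules and sup-irreducible decompositions. -/

section

variable {R : Type*} [CommRing R] {N : Type*} [AddCommGroup N] [Module R N]

/-- A module whose elements are killed by powers of `x` and whose `x`-torsion is artinian is
artinian. -/
lemma IsArtinian.of_ker_smul (x : R) (hx : ∀ a : N, ∃ k : ℕ, x ^ k • a = 0)
    (h : IsArtinian R (LinearMap.ker (LinearMap.lsmul R N x))) : IsArtinian R N := by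
  refine monotone_stabilizes_iff_artinian.1 fun L => ?_
  let L' (j : ℕ) : Submodule R N := OrderDual.ofDual (L j)
  have hL {i j : ℕ} (hij : i ≤ j) : L' j ≤ L' i := L.monotone hij
  let K := LinearMap.ker (LinearMap.lsmul R N x)
  -- The part of x^t L_j inside the kernel of x decreases in both indices. Its diagonal stabilizes
  -- at some n, and each of the rows below n stabilizes, so one J serves all t.
  let A (t j : ℕ) : Submodule R K :=
    ((L' j).map (LinearMap.lsmul R N (x ^ t))).comap K.subtype
  have hAj (t : ℕ) {i j : ℕ} (hij : i ≤ j) : A t j ≤ A t i :=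
    Submodule.comap_mono (Submodule.map_mono (hL hij))
  have hAt (j : ℕ) {s t : ℕ} (hst : s ≤ t) : A t j ≤ A s j := by
    obtain ⟨d, rfl⟩ := Nat.exists_eq_add_of_le hst
    rintro z ⟨y, hy, hyz⟩
    refine ⟨x ^ d • y, (L' j).smul_mem _ hy, ?_⟩
    rw [← hyz]
    change x ^ s • x ^ d • y = x ^ (s + d) • y
    rw [pow_add, mul_smul]
  obtain ⟨n, hn⟩ := IsArtinian.monotone_stabilizes (R := R) (M := K)
    ⟨fun t => OrderDual.toDual (A t t), fun s t hst => (hAj t hst).trans (hAt s hst)⟩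
  have hd (t : ℕ) := IsArtinian.monotone_stabilizes (R := R) (M := K)
    ⟨fun j => OrderDual.toDual (A t j), fun i j hij => hAj t hij⟩
  choose m hm using hd
  let J := n ⊔ (Finset.range n).sup m
  have hA (t j : ℕ) (hj : J ≤ j) : A t J ≤ A t j := by
    by_cases ht : t < n
    · have hmJ : m t ≤ J :=
        (Finset.le_sup (f := m) (Finset.mem_range.2 ht)).trans le_sup_right
      have h1 : A t (m t) = A t J := hm t J hmJ
      have h2 : A t (m t) = A t j := hm t j (hmJ.trans hj)
      exact (h1.symm.trans h2).le
    · have hnt : n ≤ t := not_lt.1 ht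
      have h1 : A n n = A (t ⊔ j) (t ⊔ j) := hn _ (hnt.trans le_sup_left)
      calc A t J ≤ A n J := hAt J hnt
        _ ≤ A n n := hAj n le_sup_left
        _ = A (t ⊔ j) (t ⊔ j) := h1
        _ ≤ A t (t ⊔ j) := hAt _ le_sup_left
        _ ≤ A t j := hAj t le_sup_right
  refine ⟨J, fun j hj => ?_⟩
  change L' J = L' j
  refine le_antisymm (fun a ha => ?_) (hL hj)
  -- Induct on the power of x killing `a`: an element of the smaller submodule with the same
  -- multiple by the last nonvanishing power is subtracted.
  obtain ⟨k, hk⟩ := hx a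
  induction k generalizing a with
  | zero =>
    rw [pow_zero, one_smul] at hk
    rw [hk]
    exact zero_mem _
  | succ k ih =>
    have hK : x ^ k • a ∈ K := by
      change x • x ^ k • a = 0
      rw [← mul_smul, ← pow_succ', hk]
    have hz : (⟨x ^ k • a, hK⟩ : K) ∈ A k J := ⟨a, ha, rfl⟩
    obtain ⟨y, hy, hya⟩ := hA k j hj hz
    have hya : x ^ k • y = x ^ k • a := hya
    have := ih (a - y) (sub_mem ha (hL hj hy)) (by rw [smul_sub, hya, sub_self])
    simpa using add_mem this hy

/-- On a sup-irreducible submodule of an artinian module, each scalar is either surjective or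
nilpotent. -/
lemma SupIrred.mem_radical_or_exists_smul_eq [IsArtinian R N] {S : Submodule R N}
    (hS : SupIrred S) (r : R) :
    r ∈ (Module.annihilator R S).radical ∨ ∀ a ∈ S, ∃ b ∈ S, r • b = a := by
  let f : Module.End R S := LinearMap.lsmul R S r
  -- Fitting: for large powers, kernel and range of `f` together span S, so sup-irreducibility makes
  -- one of them all of S. Taking `n + 1` keeps a spare factor of r for the preimage.
  obtain ⟨n, hn⟩ := Filter.eventually_atTop.1 f.eventually_codisjoint_ker_pow_range_pow
  have hf (k : ℕ) (a : S) : (f ^ k) a = r ^ k • a := by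
    induction k with
    | zero => simp
    | succ k ih => rw [pow_succ', Module.End.mul_apply, ih, pow_succ', mul_smul]; rfl
  have h := congrArg (Submodule.map S.subtype) (hn (n + 1) (Nat.le_succ n)).eq_top
  rw [Submodule.map_sup, Submodule.map_top, Submodule.range_subtype] at h
  refine (hS.2 h).imp (fun h => ⟨n + 1, ?_⟩) fun h a ha => ?_
  · refine Module.mem_annihilator.2 fun a => ?_
    obtain ⟨b, hb, hba⟩ := h.ge a.2
    obtain rfl : b = a := Subtype.ext hba
    rw [← hf]
    exact hb
  · obtain ⟨_, ⟨b, rfl⟩, hba⟩ := h.ge ha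
    refine ⟨r ^ n • b, S.smul_mem _ b.2, ?_⟩
    rw [← hba, hf, ← mul_smul, ← pow_succ']
    rfl

/-- If r is not in the radical it acts surjectively on S, so r^n cancels from (rs)^n S = 0. -/
lemma SupIrred.isPrime_radical_annihilator [IsArtinian R N] {S : Submodule R N}
    (hS : SupIrred S) : (Module.annihilator R S).radical.IsPrime := by
  refine ⟨fun h => hS.ne_bot ?_, fun {r s} h => ?_⟩
  · rw [Ideal.radical_eq_top, Module.annihilator_eq_top_iff] at h
    exact (Submodule.subsingleton_iff_eq_bot).1 h
  · refine or_iff_not_imp_left.2 fun hr => ?_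
    have hr := (hS.mem_radical_or_exists_smul_eq r).resolve_left hr
    obtain ⟨n, hn⟩ := h
    have hr' (k : ℕ) : ∀ a ∈ S, ∃ b ∈ S, r ^ k • b = a := by
      induction k with
      | zero => exact fun a ha => ⟨a, ha, by simp⟩
      | succ k ih =>
        intro a ha
        obtain ⟨b, hb, rfl⟩ := ih a ha
        obtain ⟨c, hc, rfl⟩ := hr b hb
        exact ⟨c, hc, by rw [pow_succ, mul_smul]⟩
    refine ⟨n, Module.mem_annihilator.2 fun a => ?_⟩
    obtain ⟨b, hb, hba⟩ := hr' n a a.2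
    obtain rfl : r ^ n • (⟨b, hb⟩ : S) = a := Subtype.ext hba
    rw [← mul_smul, mul_comm, ← mul_pow]
    exact Module.mem_annihilator.1 hn _

/-- For an artinian module `N` over a noetherian ring and a prime `m`, an element `r` outside of
finitely many primes other than `m` has `m ^ k • N ⊆ r • N` for some `k`. -/
lemma IsArtinian.exists_finite_forall_pow_smul_mem [IsNoetherianRing R] [IsArtinian R N]
    (m : Ideal R) :
    ∃ P : Set (Ideal R), P.Finite ∧ (∀ p ∈ P, p.IsPrime ∧ p ≠ m) ∧
      ∀ r, (∀ p ∈ P, r ∉ p) → ∃ k : ℕ, ∀ s ∈ m ^ k, ∀ a : N, ∃ b : N, r • b = s • a := by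
  classical
  -- On summands with radical annihilator m, a power of m acts as zero; on the others, r is
  -- surjective. Only the primes of the latter need to be avoided.
  obtain ⟨T, hT, hirr⟩ := exists_supIrred_decomposition (⊤ : Submodule R N)
  let q (S : Submodule R N) : Ideal R := (Module.annihilator R S).radical
  refine ⟨{p | ∃ S ∈ T, q S = p ∧ p ≠ m},
    (T.finite_toSet.image q).subset ?_, ?_, fun r hr => ?_⟩
  · rintro _ ⟨S, hS, rfl, -⟩
    exact ⟨S, hS, rfl⟩
  · rintro _ ⟨S, hS, rfl, hm⟩
    exact ⟨(hirr hS).isPrime_radical_annihilator, hm⟩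
  have key (S : Submodule R N) (hS : S ∈ T) :
      ∃ k : ℕ, ∀ s ∈ m ^ k, ∀ a ∈ S, ∃ b : N, r • b = s • a := by
    by_cases hm : q S = m
    · obtain ⟨k, hk⟩ := Ideal.exists_radical_pow_le_of_fg (Module.annihilator R S)
        (IsNoetherian.noetherian _)
      refine ⟨k, fun s hs a ha => ⟨0, ?_⟩⟩
      rw [← hm] at hs
      rw [smul_zero]
      exact (congrArg Subtype.val (Module.mem_annihilator.1 (hk hs) ⟨a, ha⟩)).symm
    · refine ⟨0, fun s _ a ha => ?_⟩
      obtain ⟨b, -, hb⟩ := ((hirr hS).mem_radical_or_exists_smul_eq r).resolve_left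
        (hr _ ⟨S, hS, rfl, hm⟩) (s • a) (S.smul_mem s ha)
      exact ⟨b, hb⟩
  choose! k hk using key
  refine ⟨T.sup k, fun s hs a => ?_⟩
  have : T.sup id ≤ (LinearMap.range (LinearMap.lsmul R N r)).comap (LinearMap.lsmul R N s) :=
    Finset.sup_le fun S hS a ha =>
      hk S hS s (Ideal.pow_le_pow_right (Finset.le_sup hS) hs) a ha
  exact this (hT ▸ Submodule.mem_top)

end

/-! ### Finite torsion modules, and prime avoidance over local rings. -/

namespace LocalCohomologySpec

/-- In a prime filtration, every factor R/p is torsion, so p is maximal and the factor is simple. -/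
lemma IsTorsion.isArtinian {R : Type u} [CommRing R] [IsNoetherianRing R] {M : Type u}
    [AddCommGroup M] [Module R M] [Module.Finite R M] (hM : IsTorsion (maxSpec R) M) :
    IsArtinian R M := by
  revert hM
  refine IsNoetherianRing.induction_on_isQuotientEquivQuotientPrime R (M := M) inferInstance
    (motive := fun N _ _ _ => IsTorsion (maxSpec R) N → IsArtinian R N) ?_ ?_ ?_
  · intro N _ _ _ _ _
    infer_instance
  · intro N _ _ _ p e hN
    have hp := (hN.of_injective e.symm.injective).support_subset
      (show p ∈ Module.support R (R ⧸ p.asIdeal) by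
        rw [Module.support_eq_zeroLocus, Ideal.annihilator_quotient]
        exact le_refl p.asIdeal)
    have : p.asIdeal.IsMaximal := hp
    have : IsSimpleModule R (R ⧸ p.asIdeal) := isSimpleModule_iff_isCoatom.2 this.out
    exact isArtinian_of_linearEquiv e.symm
  · intro N₁ _ _ _ N₂ _ _ _ N₃ _ _ _ f g hf hg hfg h₁ h₃ h
    have := h₁ (h.of_injective hf)
    have := h₃ (h.of_surjective hg)
    exact isArtinian_of_range_eq_ker f g hfg.linearMap_ker_eq.symm

section

variable {R : Type u} [CommRing R] [IsLocalRing R] {M : Type u} [AddCommGroup M] [Module R M]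

open IsLocalRing

lemma mem_maxSpec_iff_of_isLocalRing {p : PrimeSpectrum R} :
    p ∈ maxSpec R ↔ p.asIdeal = maximalIdeal R :=
  ⟨fun h => eq_maximalIdeal h, fun h =>
    show p.asIdeal.IsMaximal from h.symm ▸ maximalIdeal.isMaximal R⟩

lemma mem_torsionSubmodule_maxSpec_of_forall {x : M} (h : ∀ r ∈ maximalIdeal R, r • x = 0) :
    x ∈ torsionSubmodule (maxSpec R) M := by
  refine mem_torsionSubmodule_iff.2 fun p hp => ?_
  have hle : ¬ maximalIdeal R ≤ p.asIdeal := fun hle =>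
    hp (mem_maxSpec_iff_of_isLocalRing.2 (le_antisymm (le_maximalIdeal p.isPrime.ne_top) hle))
  obtain ⟨r, hr, hrp⟩ := SetLike.not_le_iff_exists.1 hle
  exact ⟨r, hrp, h r hr⟩

/-- No prime other than the maximal ideal contains the annihilator of x, so its radical contains the
maximal ideal. -/
lemma exists_pow_smul_eq_zero_of_mem_torsionSubmodule {x : M}
    (hx : x ∈ torsionSubmodule (maxSpec R) M) {r : R} (hr : r ∈ maximalIdeal R) :
    ∃ k : ℕ, r ^ k • x = 0 := by
  suffices r ∈ Ideal.radical (LinearMap.ker (LinearMap.toSpanSingleton R M x)) by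
    obtain ⟨k, hk⟩ := this
    exact ⟨k, hk⟩
  rw [Ideal.radical_eq_sInf, Ideal.mem_sInf]
  rintro p ⟨hp, hprime⟩
  by_contra hrp
  obtain ⟨s, hs, hsx⟩ := mem_torsionSubmodule_iff.1 hx ⟨p, hprime⟩ fun h =>
    hrp ((mem_maxSpec_iff_of_isLocalRing.1 h).ge hr)
  exact hs (hp hsx)

variable [IsNoetherianRing R]

/-- Prime avoidance for regular elements. -/
lemma exists_isSMulRegular_of_torsionSubmodule_eq_bot [Module.Finite R M]
    (hM : torsionSubmodule (maxSpec R) M = ⊥) {P : Set (Ideal R)} (hP : P.Finite)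
    (hPp : ∀ p ∈ P, p.IsPrime ∧ p ≠ maximalIdeal R) :
    ∃ r ∈ maximalIdeal R, IsSMulRegular M r ∧ ∀ p ∈ P, r ∉ p := by
  -- An element with annihilator the maximal ideal would be nonzero torsion.
  have hass : ∀ p ∈ associatedPrimes R M, p.IsPrime ∧ p ≠ maximalIdeal R := by
    refine fun p hp => ⟨hp.isPrime, ?_⟩
    rintro rfl
    obtain ⟨-, x, hx⟩ := isAssociatedPrime_iff.1 hp
    have hx0 : x = 0 := by
      rw [← Submodule.mem_bot R, ← hM]
      refine mem_torsionSubmodule_maxSpec_of_forall fun r hr => ?_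
      rw [hx] at hr
      simpa [Submodule.mem_colon_singleton] using hr
    subst hx0
    apply (maximalIdeal.isMaximal R).ne_top
    rw [hx, Ideal.eq_top_iff_one]
    simp [Submodule.mem_colon_singleton]
  have hU := (associatedPrimes.finite R M).union hP
  have hall : ∀ p ∈ associatedPrimes R M ∪ P, p.IsPrime ∧ p ≠ maximalIdeal R :=
    fun p hp => hp.elim (hass p) (hPp p)
  have hsub : ¬ (maximalIdeal R : Set R) ⊆
      ⋃ p ∈ associatedPrimes R M ∪ P, (p : Set R) := by
    -- Prime avoidance tolerates two non-prime ideals; all ideals here are prime, so the two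
    -- exceptional indices `⊥ ⊥` are placeholders.
    rw [Ideal.subset_union_prime_finite hU (f := fun p => p) ⊥ ⊥ fun p hp _ _ => (hall p hp).1]
    rintro ⟨p, hp, hle⟩
    exact (hall p hp).2 (le_antisymm (le_maximalIdeal (hall p hp).1.ne_top) hle)
  obtain ⟨r, hr, hr'⟩ := Set.not_subset.1 hsub
  simp only [Set.mem_iUnion, not_exists] at hr'
  refine ⟨r, hr, ?_, fun p hp => hr' p (Or.inr hp)⟩
  by_contra h
  have : r ∈ {r | IsSMulRegular M r}ᶜ := h
  rw [← biUnion_associatedPrimes_eq_compl_regular] at this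
  obtain ⟨p, hp, hrp⟩ := Set.mem_iUnion₂.1 this
  exact hr' p (Or.inl hp) hrp

end

end LocalCohomologySpec

/-! ### Artinianness and Grothendieck's nonvanishing theorem. -/

namespace LocalCohomologySpec

section

open IsLocalRing Module
open scoped Pointwise

variable {R : Type u} [CommRing R] [IsLocalRing R] {M : Type u} [AddCommGroup M] [Module R M]

/-- Only the closed point could leave the support. In positive dimension a non-maximal prime
remains, and the closed point is one of its specializations. -/
lemma supportDim_quotient_torsionSubmodule (hM : 1 ≤ supportDim R M) :
    supportDim R (M ⧸ torsionSubmodule (maxSpec R) M) = supportDim R M := by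
  have hsupp := Module.support_of_exact
    (LinearMap.exact_subtype_mkQ (torsionSubmodule (maxSpec R) M))
    (Submodule.subtype_injective _) (Submodule.mkQ_surjective _)
  have hΓ := (isTorsion_torsionSubmodule (Φ := maxSpec R) (M := M)).support_subset
  obtain ⟨⟨p, hp⟩, ⟨q, hq⟩, hpq⟩ := Order.one_le_krullDim_iff.1 hM
  have hpq : p < q := hpq
  have hpmax : p ∉ maxSpec R := fun h =>
    hpq.not_ge ((le_maximalIdeal q.isPrime.ne_top).trans (mem_maxSpec_iff_of_isLocalRing.1 h).ge)
  have hp' : p ∈ support R (M ⧸ torsionSubmodule (maxSpec R) M) :=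
    (hsupp.le hp).resolve_left fun h => hpmax (hΓ h)
  have : support R M = support R (M ⧸ torsionSubmodule (maxSpec R) M) := by
    rw [hsupp, Set.union_eq_right]
    intro 𝔪 h𝔪
    refine mem_support_mono (show p ≤ 𝔪 from ?_) hp'
    exact (le_maximalIdeal p.isPrime.ne_top).trans (mem_maxSpec_iff_of_isLocalRing.1 (hΓ h𝔪)).ge
  rw [supportDim, supportDim, this]

namespace LocalCohomology

variable [IsNoetherianRing R] [Module.Finite R M]

/-- The local cohomology of a finite module over a noetherian local ring is artinian. -/
theorem isArtinian (M : Type u) [AddCommGroup M] [Module R M] [Module.Finite R M] (i : ℕ) :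
    IsArtinian R (LocalCohomology (maxSpec R) M i) := by
  induction i generalizing M with
  | zero =>
    have := (isTorsion_torsionSubmodule (Φ := maxSpec R) (M := M)).isArtinian
    exact isArtinian_of_linearEquiv (zeroEquiv (maxSpec R)).symm
  | succ i ih =>
    suffices IsArtinian R
        (LocalCohomology (maxSpec R) (M ⧸ torsionSubmodule (maxSpec R) M) (i + 1)) from
      isArtinian_of_injective _ (injective_map_mkQ_torsionSubmodule i)
    obtain ⟨r, hrm, hr, -⟩ := exists_isSMulRegular_of_torsionSubmodule_eq_bot
      (torsionSubmodule_quotient_eq_bot (Φ := maxSpec R) (M := M)) Set.finite_empty (by simp)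
    -- The r-torsion of H^(i+1) is a quotient of H^i of the module modulo r, which is artinian by
    -- induction.
    refine IsArtinian.of_ker_smul r (fun a =>
      exists_pow_smul_eq_zero_of_mem_torsionSubmodule ((isTorsion _ _).mem a) hrm) ?_
    have : LinearMap.ker (LinearMap.lsmul R _ r) = LinearMap.range (regularδ (maxSpec R) hr i) := by
      ext x
      exact (mem_range_regularδ_iff hr i).symm
    rw [this]
    have := ih (QuotSMulTop r (M ⧸ torsionSubmodule (maxSpec R) M))
    exact isArtinian_of_surjective _ _ (LinearMap.surjective_rangeRestrict _)

/-- The top local cohomology in positive degree vanishes as soon as it is killed by a power of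
the maximal ideal. -/
lemma subsingleton_of_pow_smul_eq_zero {n : ℕ} (hM : supportDim R M = (n + 1 : ℕ)) {k : ℕ}
    (hk : ∀ s ∈ maximalIdeal R ^ k, ∀ x : LocalCohomology (maxSpec R) M (n + 1), s • x = 0) :
    Subsingleton (LocalCohomology (maxSpec R) M (n + 1)) := by
  have hM1 : 1 ≤ supportDim R M := by rw [hM]; norm_cast; lia
  suffices Subsingleton
      (LocalCohomology (maxSpec R) (M ⧸ torsionSubmodule (maxSpec R) M) (n + 1)) from
    (injective_map_mkQ_torsionSubmodule n).subsingleton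
  obtain ⟨r, hrm, hr, -⟩ := exists_isSMulRegular_of_torsionSubmodule_eq_bot
    (torsionSubmodule_quotient_eq_bot (Φ := maxSpec R) (M := M)) Set.finite_empty (by simp)
  have hdim := supportDim_quotSMulTop_succ_eq_supportDim hr hrm
  rw [supportDim_quotient_torsionSubmodule hM1, hM, Nat.cast_add, Nat.cast_one,
    ENat.WithBot.add_one_cancel] at hdim
  have := subsingleton_of_supportDim_le (Nat.lt_succ_self n) hdim.le
  -- The quotient by r has dimension n, so its H^(n+1) vanishes and r acts surjectively. Then r^k is
  -- both surjective and zero.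
  have hsurj : ∀ x : LocalCohomology (maxSpec R) (M ⧸ torsionSubmodule (maxSpec R) M) (n + 1),
      ∃ y, r • y = x := fun x => (map_mkQ_eq_zero_iff hr (n + 1)).1 (Subsingleton.elim _ _)
  have hpow (k : ℕ) :
      ∀ x : LocalCohomology (maxSpec R) (M ⧸ torsionSubmodule (maxSpec R) M) (n + 1),
      ∃ y, r ^ k • y = x := by
    induction k with
    | zero => exact fun x => ⟨x, by simp⟩
    | succ k ih =>
      intro x
      obtain ⟨y, rfl⟩ := ih x
      obtain ⟨z, rfl⟩ := hsurj y
      exact ⟨z, by rw [pow_succ, mul_smul]⟩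
  refine subsingleton_of_forall_eq 0 fun x => ?_
  obtain ⟨y, rfl⟩ := hpow k x
  obtain ⟨z, rfl⟩ := surjective_map_mkQ_torsionSubmodule (n + 1) y
  rw [← map_smul, hk _ (Ideal.pow_mem_pow hrm k), _root_.map_zero]

/-- Grothendieck's nonvanishing theorem. -/
theorem nontrivial_of_supportDim_eq {n : ℕ} (M : Type u) [AddCommGroup M] [Module R M]
    [Module.Finite R M] (hM : supportDim R M = n) :
    Nontrivial (LocalCohomology (maxSpec R) M n) := by
  induction n generalizing M with
  | zero =>
    have hM0 : Nontrivial M := (supportDim_ne_bot_iff_nontrivial R M).1 (by rw [hM]; simp)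
    have hT : IsTorsion (maxSpec R) M := by
      rw [isTorsion_iff_support_subset, support_of_supportDim_eq_zero R M (by simpa using hM)]
      intro p hp
      exact mem_maxSpec_iff_of_isLocalRing.2 (le_antisymm (le_maximalIdeal p.isPrime.ne_top) hp)
    exact ((zeroEquiv (maxSpec R)).trans (LinearEquiv.ofTop _ hT)).toEquiv.nontrivial
  | succ n ih =>
    have key (M : Type u) [AddCommGroup M] [Module R M] [Module.Finite R M]
        (hM : supportDim R M = (n + 1 : ℕ)) (hΓ : torsionSubmodule (maxSpec R) M = ⊥) :
        Nontrivial (LocalCohomology (maxSpec R) M (n + 1)) := by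
      rw [← not_subsingleton_iff_nontrivial]
      intro hsub
      have := isArtinian (R := R) M n
      -- If H^(n+1)(M) = 0, then H^n(M/rM) is H^n(M)/rH^n(M). Avoiding these primes makes a power of
      -- the maximal ideal kill it, contradicting its nonvanishing in top degree.
      obtain ⟨P, hP, hPp, hPk⟩ := IsArtinian.exists_finite_forall_pow_smul_mem
        (N := LocalCohomology (maxSpec R) M n) (maximalIdeal R)
      obtain ⟨r, hrm, hr, hrP⟩ := exists_isSMulRegular_of_torsionSubmodule_eq_bot hΓ hP hPp
      obtain ⟨k, hk⟩ := hPk r hrP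
      have hdim := supportDim_quotSMulTop_succ_eq_supportDim hr hrm
      rw [hM, Nat.cast_add, Nat.cast_one, ENat.WithBot.add_one_cancel] at hdim
      have hnt := ih (QuotSMulTop r M) hdim
      have hsurj : Function.Surjective
          (map (maxSpec R) n (r • (⊤ : Submodule R M)).mkQ) := fun x =>
        (mem_range_map_mkQ_iff hr n).2 (Subsingleton.elim _ _)
      rw [← not_subsingleton_iff_nontrivial] at hnt
      cases n with
      -- Being killed by a power of the maximal ideal is no contradiction in degree zero; here the
      -- torsion-freeness of M gives H^0(M) = 0 instead.
      | zero =>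
        have : Subsingleton (torsionSubmodule (maxSpec R) M) := by rw [hΓ]; infer_instance
        have : Subsingleton (LocalCohomology (maxSpec R) M 0) :=
          (zeroEquiv (maxSpec R)).toEquiv.subsingleton
        exact hnt hsurj.subsingleton
      | succ n =>
        refine hnt (subsingleton_of_pow_smul_eq_zero hdim (k := k) fun s hs x => ?_)
        obtain ⟨y, rfl⟩ := hsurj x
        rw [← map_smul, map_mkQ_eq_zero_iff hr]
        exact hk s hs y
    have hM1 : 1 ≤ supportDim R M := by rw [hM]; norm_cast; lia
    have := key (M ⧸ torsionSubmodule (maxSpec R) M)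
      ((supportDim_quotient_torsionSubmodule hM1).trans hM) torsionSubmodule_quotient_eq_bot
    exact (surjective_map_mkQ_torsionSubmodule (n + 1)).nontrivial

end LocalCohomology

end

end LocalCohomologySpec

/-! ### Passing between R and its localizations at maximal ideals. -/

/-- Restriction of scalars along a flat ring homomorphism preserves injective modules. -/
lemma ModuleCat.injective_restrictScalars_of_flat {R S : Type u} [CommRing R] [CommRing S]
    {f : R →+* S} (hf : f.Flat) (I : ModuleCat.{u} S) [Injective I] :
    Injective ((ModuleCat.restrictScalars.{u} f).obj I) := by
  have : (ModuleCat.extendScalars.{u} f).PreservesMonomorphisms := by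
    refine ⟨fun {A B} g hg => (ModuleCat.mono_iff_injective _).2 ?_⟩
    algebraize [f]
    exact Module.Flat.lTensor_preserves_injective_linearMap (M := S) g.hom
      ((ModuleCat.mono_iff_injective _).1 hg)
  exact Injective.injective_of_adjoint (ModuleCat.extendRestrictScalarsAdj f) I

namespace LocalCohomologySpec

section

variable {R : Type u} [CommRing R] (m : Ideal R) [m.IsMaximal]

/-- Over the localization at a maximal ideal, torsion with respect to the maximal spectra of the
base ring and of the localization agree. -/
lemma mem_torsionSubmodule_localization_iff {N : Type u} [AddCommGroup N] [Module R N]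
    [Module (Localization.AtPrime m) N] [IsScalarTower R (Localization.AtPrime m) N] {x : N} :
    x ∈ torsionSubmodule (maxSpec R) N ↔
      x ∈ torsionSubmodule (maxSpec (Localization.AtPrime m)) N := by
  have hcomap := IsLocalization.AtPrime.under_maximalIdeal (Localization.AtPrime m) m
  constructor <;> intro hx
  · refine mem_torsionSubmodule_iff.2 fun q hq => ?_
    -- A maximal contraction of q lies in m, hence equals m, which would force q to be the maximal
    -- ideal of the localization.
    have hp : PrimeSpectrum.comap (algebraMap R (Localization.AtPrime m)) q ∉ maxSpec R := by
      intro hp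
      refine hq (mem_maxSpec_iff_of_isLocalRing.2
        (le_antisymm (IsLocalRing.le_maximalIdeal q.isPrime.ne_top) ?_))
      have hp : (q.asIdeal.comap (algebraMap R (Localization.AtPrime m))).IsMaximal := hp
      have hle : q.asIdeal.comap (algebraMap R (Localization.AtPrime m)) ≤ m := by
        refine le_of_le_of_eq ?_ hcomap
        exact Ideal.comap_mono (IsLocalRing.le_maximalIdeal q.isPrime.ne_top)
      have he := hp.eq_of_le (Ideal.IsMaximal.ne_top ‹_›) hle
      rw [← Localization.AtPrime.map_eq_maximalIdeal, Ideal.map_le_iff_le_comap, he]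
    obtain ⟨r, hr, hrx⟩ := mem_torsionSubmodule_iff.1 hx _ hp
    exact ⟨algebraMap R _ r, hr, by rwa [algebraMap_smul]⟩
  · refine mem_torsionSubmodule_iff.2 fun p hp => ?_
    have hle : ¬ m ≤ p.asIdeal := fun hle => hp
      (show p.asIdeal.IsMaximal from
        Ideal.IsMaximal.eq_of_le (I := m) inferInstance p.isPrime.ne_top hle ▸ inferInstance)
    -- Such an `r` maps into the maximal ideal of the localization, so a power of it kills x while
    -- staying outside p.
    obtain ⟨r, hrm, hrp⟩ := SetLike.not_le_iff_exists.1 hle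
    obtain ⟨k, hk⟩ := exists_pow_smul_eq_zero_of_mem_torsionSubmodule hx
      (r := algebraMap R _ r) (by rw [← hcomap] at hrm; exact hrm)
    refine ⟨r ^ k, fun h => hrp (p.isPrime.mem_of_pow_mem k h), ?_⟩
    rwa [← map_pow, algebraMap_smul] at hk

lemma mem_torsionSubmodule_restrictScalars_iff {N : ModuleCat.{u} (Localization.AtPrime m)}
    {x : (ModuleCat.restrictScalars.{u} (algebraMap R (Localization.AtPrime m))).obj N} :
    x ∈ torsionSubmodule (maxSpec R) _ ↔
      (show N from x) ∈ torsionSubmodule (maxSpec (Localization.AtPrime m)) N := by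
  let : Module R N := Module.compHom N (algebraMap R (Localization.AtPrime m))
  have : IsScalarTower R (Localization.AtPrime m) N :=
    ⟨fun r s y => by rw [Algebra.smul_def, mul_smul]; rfl⟩
  exact mem_torsionSubmodule_localization_iff (N := N) m

/-- Restriction of scalars sends the torsion submodule to the torsion submodule. -/
noncomputable def torsionSubmoduleRestrictScalarsEquiv
    (N : ModuleCat.{u} (Localization.AtPrime m)) :
    torsionSubmodule (maxSpec R) ((ModuleCat.restrictScalars.{u}
      (algebraMap R (Localization.AtPrime m))).obj N) ≃ₗ[R]
    (ModuleCat.restrictScalars.{u} (algebraMap R (Localization.AtPrime m))).obj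
      ((torsionFunctor (maxSpec (Localization.AtPrime m))).obj N) where
  toFun x := (⟨x.1, (mem_torsionSubmodule_restrictScalars_iff m).1 x.2⟩ :
    torsionSubmodule (maxSpec (Localization.AtPrime m)) N)
  invFun (x : torsionSubmodule (maxSpec (Localization.AtPrime m)) N) :=
    ⟨x.1, (mem_torsionSubmodule_restrictScalars_iff m).2 x.2⟩
  map_add' _ _ := rfl
  map_smul' _ _ := rfl
  left_inv _ := rfl
  right_inv _ := rfl

/-- The maximal-torsion functor commutes with restriction of scalars along a localization at a
maximal ideal. -/
noncomputable def restrictScalarsCompTorsionFunctorIso :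
    ModuleCat.restrictScalars.{u} (algebraMap R (Localization.AtPrime m)) ⋙
        torsionFunctor (maxSpec R) ≅
      torsionFunctor (maxSpec (Localization.AtPrime m)) ⋙
        ModuleCat.restrictScalars.{u} (algebraMap R (Localization.AtPrime m)) :=
  NatIso.ofComponents (fun N => (torsionSubmoduleRestrictScalarsEquiv m N).toModuleIso)
    fun _ => rfl

variable [IsNoetherianRing R]

/-- The witness is R_m itself, viewed over R: its cohomology can be computed over R_m, where n is
the dimension and Grothendieck's theorem applies. -/
lemma exists_not_isZero_localCohomologyFunctor_of_height_eq {n : ℕ} (hn : m.height = n) :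
    ∃ M : ModuleCat.{u} R, ¬ Limits.IsZero ((localCohomologyFunctor (maxSpec R) n).obj M) := by
  obtain ⟨e⟩ := Functor.nonempty_rightDerived_obj_iso
    (ModuleCat.restrictScalars.{u} (algebraMap R (Localization.AtPrime m)))
    (fun I _ => ModuleCat.injective_restrictScalars_of_flat
      (RingHom.flat_algebraMap_iff.2 inferInstance) I)
    (torsionFunctor (maxSpec (Localization.AtPrime m))) (torsionFunctor (maxSpec R))
    (ModuleCat.restrictScalars.{u} (algebraMap R (Localization.AtPrime m)))
    (restrictScalarsCompTorsionFunctorIso m) n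
    (ModuleCat.of (Localization.AtPrime m) (Localization.AtPrime m))
  refine ⟨(ModuleCat.restrictScalars.{u} (algebraMap R (Localization.AtPrime m))).obj
    (ModuleCat.of (Localization.AtPrime m) (Localization.AtPrime m)), fun hzero => ?_⟩
  have hsub := ModuleCat.subsingleton_of_isZero (hzero.of_iso e.symm)
  have hnt := LocalCohomology.nontrivial_of_supportDim_eq (n := n) (Localization.AtPrime m) (by
    rw [Module.supportDim_self_eq_ringKrullDim,
      IsLocalization.AtPrime.ringKrullDim_eq_height m, hn]
    rfl)
  exact not_subsingleton_iff_nontrivial.2 hnt hsub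

variable (R) in
-- The dimension is tested on heights of maximal ideals, each finite and attained as a degree of
-- nonvanishing. No finiteness of dim R is needed.
lemma ringKrullDim_le_cohomologicalDimension_maxSpec :
    ringKrullDim R ≤ cohomologicalDimension (maxSpec R) := by
  rw [ringKrullDim_le_iff_isMaximal_height_le]
  intro m hm
  obtain ⟨n, hn⟩ := ENat.ne_top_iff_exists.1 (Ideal.height_ne_top hm.ne_top)
  rw [← hn]
  exact le_sSup ⟨n, exists_not_isZero_localCohomologyFunctor_of_height_eq m hn.symm, rfl⟩

lemma cohomologicalDimension_maxSpec_le {d : ℕ} (hd : ringKrullDim R ≤ d) :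
    cohomologicalDimension (maxSpec R) ≤ d := by
  refine sSup_le ?_
  rintro _ ⟨n, ⟨M, hM⟩, rfl⟩
  by_contra hlt
  have hdn : d < n := by
    rw [not_le] at hlt
    exact_mod_cast hlt
  have := LocalCohomology.subsingleton_of_ringKrullDim_le hdn hd M
  exact hM (ModuleCat.isZero_of_subsingleton _)

end

end LocalCohomologySpec

theorem mainTheorem8 (R : Type u) [CommRing R] [IsNoetherianRing R] :
    (LocalCohomologySpec.cohomologicalDimension (LocalCohomologySpec.maxSpec R) < ⊤ ↔
        ringKrullDim R < ⊤) ∧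
      (ringKrullDim R = ⊤ →
        LocalCohomologySpec.cohomologicalDimension (LocalCohomologySpec.maxSpec R) = ⊤) := by
  have hle := LocalCohomologySpec.ringKrullDim_le_cohomologicalDimension_maxSpec R
  refine ⟨⟨hle.trans_lt, fun h => ?_⟩, fun h => top_le_iff.1 (h ▸ hle)⟩
  obtain ⟨d, hd⟩ : ∃ d : ℕ, ringKrullDim R ≤ d := by
    generalize ringKrullDim R = k at h
    induction k with
    -- For the zero ring any natural number bounds the dimension -∞.
    | bot => exact ⟨0, bot_le⟩
    | coe k =>
      obtain ⟨d, rfl⟩ := ENat.ne_top_iff_exists.1 fun hk : k = ⊤ => h.ne (by rw [hk]; rfl)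
      exact ⟨d, le_rfl⟩
  exact (LocalCohomologySpec.cohomologicalDimension_maxSpec_le hd).trans_lt
    (WithBot.coe_lt_coe.2 (ENat.natCast_lt_top d))
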